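/- Fix an integer $D\ge 0$. We work in the real RAM model: a program has a memory of natural-number cells and exact real-number cells with indirect addressing by natural numbers. It may add, subtract and compare natural numbers; add, subtract, multiply, divide and compare real numbers; and take the largest real root of a polynomial whose degree is fixed in the program. The only constants in a program are natural numbers, and each operation, memory access or comparison costs one unit of time. Then there are a program $P_D$ and a constant $c_D$, both depending only on $D$, such that the following holds. Let $N\ge 1$, let $\sigma\in\mathbb{R}$, let $A$ be a real symmetric positive semidefinite $N\times N$ matrix of rank $D$, let $C=\sigma I_N+A$, and let $K\in\{1,\dots,N\}$. Given $N$, $K$ and the entries of $C$ as input, $P_D$ halts after at most $c_D\,N^{D+1}$ units of time and outputs a vector $x\in\mathbb{R}^N$ that maximizes $x^{T}Cx$ subject to $\|x\|=1$ and $\operatorname{card}(x)\le K$, where $\operatorname{card}(x)$ is the number of nonzero entries of $x$. In other words, for every fixed $D$, the $K$-sparse principal component of a rank-$D$ update of a multiple of the identity can be computed in time $\mathcal{O}(N^{D+1})$. -/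

import Mathlib

/-! A real random access machine, written as a small structured programming language.

The memory consists of arrays of natural numbers (cells `(a, i)`) and of two-dimensional arrays of
real numbers (cells `(a, i, j)`). Array names `a` are constants of the program, while the indices
`i`, `j` are computed (indirect addressing). Natural numbers can be added, subtracted (truncated)
and compared. Real numbers are exact, and can be added, subtracted, multiplied, divided and
compared; moreover the machine can take the largest real root of a polynomial whose degree is fixed
in the text of the program (a square root is the case of degree two). The only constants in a
program are natural numbers, and there is no conversion (such as a floor) of reals to integers.
Every operation, memory access and comparison costs one unit of time. -/

namespace RealRAM

/-- Expressions for natural numbers; `read a i` is the content of cell `i` of array `a`. -/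
inductive NExpr : Type
  | lit (n : ℕ) : NExpr
  | read (a : ℕ) (i : NExpr) : NExpr
  | add (e f : NExpr) : NExpr
  | sub (e f : NExpr) : NExpr

/-- Expressions for real numbers; `read a i j` is the content of cell `(i, j)` of array `a`. -/
inductive RExpr : Type
  | lit (n : ℕ) : RExpr
  | read (a : ℕ) (i j : NExpr) : RExpr
  | add (e f : RExpr) : RExpr
  | sub (e f : RExpr) : RExpr
  | mul (e f : RExpr) : RExpr
  | div (e f : RExpr) : RExpr

/-- Tests, for branching. -/
inductive Test : Type
  | natLt (e f : NExpr) : Test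
  | realLt (e f : RExpr) : Test
  | neg (b : Test) : Test

/-- Programs. The command `setRoot a i j cs` stores in the real cell `(a, i, j)` the largest real
root of the polynomial whose coefficients, beginning with the constant one, are listed in `cs`. -/
inductive Program : Type
  | skip : Program
  | setNat (a : ℕ) (i e : NExpr) : Program
  | setReal (a : ℕ) (i j : NExpr) (e : RExpr) : Program
  | setRoot (a : ℕ) (i j : NExpr) (cs : List RExpr) : Program
  | seq (p q : Program) : Program
  | ite (b : Test) (p q : Program) : Program
  | loop (b : Test) (p : Program) : Program

/-- The content of the memory. -/
@[ext] structure Memory : Type where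
  nat : ℕ → ℕ → ℕ
  real : ℕ → ℕ → ℕ → ℝ

/-- The memory after storing the natural number `v` in cell `(a, i)`. -/
def Memory.storeNat (m : Memory) (a i v : ℕ) : Memory where
  nat := fun a' i' => if a' = a ∧ i' = i then v else m.nat a' i'
  real := m.real

/-- The memory after storing the real number `v` in cell `(a, i, j)`. -/
noncomputable def Memory.storeReal (m : Memory) (a i j : ℕ) (v : ℝ) : Memory where
  nat := m.nat
  real := fun a' i' j' => if a' = a ∧ i' = i ∧ j' = j then v else m.real a' i' j'

/-- The value `c₀ + c₁ t + c₂ t² + ⋯` at `t` of the polynomial with coefficients `[c₀, c₁, …]`. -/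
def polyVal (cs : List ℝ) (t : ℝ) : ℝ :=
  cs.foldr (fun c v => c + t * v) 0

/-- The largest real root of the polynomial with coefficients `cs`. For a polynomial without real
roots, and for the zero polynomial, the supremum takes its default value `0`. -/
noncomputable def largestRoot (cs : List ℝ) : ℝ :=
  sSup {t : ℝ | polyVal cs t = 0}

def NExpr.eval (m : Memory) : NExpr → ℕ
  | lit n => n
  | read a i => m.nat a (i.eval m)
  | add e f => e.eval m + f.eval m
  | sub e f => e.eval m - f.eval m

def NExpr.cost : NExpr → ℕ
  | lit _ => 1
  | read _ i => 1 + i.cost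
  | add e f => 1 + e.cost + f.cost
  | sub e f => 1 + e.cost + f.cost

noncomputable def RExpr.eval (m : Memory) : RExpr → ℝ
  | lit n => (n : ℝ)
  | read a i j => m.real a (i.eval m) (j.eval m)
  | add e f => e.eval m + f.eval m
  | sub e f => e.eval m - f.eval m
  | mul e f => e.eval m * f.eval m
  | div e f => e.eval m / f.eval m

def RExpr.cost : RExpr → ℕ
  | lit _ => 1
  | read _ i j => 1 + i.cost + j.cost
  | add e f => 1 + e.cost + f.cost
  | sub e f => 1 + e.cost + f.cost
  | mul e f => 1 + e.cost + f.cost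
  | div e f => 1 + e.cost + f.cost

def Test.Holds (m : Memory) : Test → Prop
  | natLt e f => e.eval m < f.eval m
  | realLt e f => e.eval m < f.eval m
  | neg b => ¬ b.Holds m

def Test.cost : Test → ℕ
  | natLt e f => 1 + e.cost + f.cost
  | realLt e f => 1 + e.cost + f.cost
  | neg b => 1 + b.cost

/-- `Runs p m t m'`: the program `p`, started with memory `m`, halts after exactly `t` units of
time with memory `m'`. -/
inductive Runs : Program → Memory → ℕ → Memory → Prop
  | skip (m : Memory) : Runs .skip m 1 m
  | setNat (a : ℕ) (i e : NExpr) (m : Memory) :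
      Runs (.setNat a i e) m (1 + i.cost + e.cost) (m.storeNat a (i.eval m) (e.eval m))
  | setReal (a : ℕ) (i j : NExpr) (e : RExpr) (m : Memory) :
      Runs (.setReal a i j e) m (1 + i.cost + j.cost + e.cost)
        (m.storeReal a (i.eval m) (j.eval m) (e.eval m))
  | setRoot (a : ℕ) (i j : NExpr) (cs : List RExpr) (m : Memory) :
      Runs (.setRoot a i j cs) m (1 + i.cost + j.cost + (cs.map RExpr.cost).sum)
        (m.storeReal a (i.eval m) (j.eval m) (largestRoot (cs.map (RExpr.eval m))))
  | seq {p q : Program} {m₀ m₁ m₂ : Memory} {t₁ t₂ : ℕ}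
      (hp : Runs p m₀ t₁ m₁) (hq : Runs q m₁ t₂ m₂) : Runs (.seq p q) m₀ (t₁ + t₂) m₂
  | ite_true {b : Test} {p : Program} (q : Program) {m m' : Memory} {t : ℕ}
      (hb : b.Holds m) (hp : Runs p m t m') : Runs (.ite b p q) m (b.cost + t) m'
  | ite_false {b : Test} (p : Program) {q : Program} {m m' : Memory} {t : ℕ}
      (hb : ¬ b.Holds m) (hq : Runs q m t m') : Runs (.ite b p q) m (b.cost + t) m'
  | loop_done {b : Test} (p : Program) {m : Memory}
      (hb : ¬ b.Holds m) : Runs (.loop b p) m b.cost m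
  | loop_step {b : Test} {p : Program} {m₀ m₁ m₂ : Memory} {t₁ t₂ : ℕ}
      (hb : b.Holds m₀) (hp : Runs p m₀ t₁ m₁) (hl : Runs (.loop b p) m₁ t₂ m₂) :
      Runs (.loop b p) m₀ (b.cost + t₁ + t₂) m₂

/-- The machine is deterministic. -/
theorem Runs.unique {p : Program} {m m₁ m₂ : Memory} {t₁ t₂ : ℕ}
    (h₁ : Runs p m t₁ m₁) (h₂ : Runs p m t₂ m₂) : t₁ = t₂ ∧ m₁ = m₂ := by
  induction h₁ generalizing t₂ m₂ with
  | skip => cases h₂; exact ⟨rfl, rfl⟩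
  | setNat => cases h₂; exact ⟨rfl, rfl⟩
  | setReal => cases h₂; exact ⟨rfl, rfl⟩
  | setRoot => cases h₂; exact ⟨rfl, rfl⟩
  | seq _ _ ih₁ ih₂ =>
    cases h₂ with
    | seq hp hq =>
      obtain ⟨rfl, rfl⟩ := ih₁ hp
      obtain ⟨rfl, rfl⟩ := ih₂ hq
      exact ⟨rfl, rfl⟩
  | ite_true _ hb _ ih =>
    cases h₂ with
    | ite_true _ _ hp => obtain ⟨rfl, rfl⟩ := ih hp; exact ⟨rfl, rfl⟩
    | ite_false _ hb₂ _ => exact absurd hb hb₂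
  | ite_false _ hb _ ih =>
    cases h₂ with
    | ite_true _ hb₂ _ => exact absurd hb₂ hb
    | ite_false _ _ hq => obtain ⟨rfl, rfl⟩ := ih hq; exact ⟨rfl, rfl⟩
  | loop_done _ hb =>
    cases h₂ with
    | loop_done => exact ⟨rfl, rfl⟩
    | loop_step hb₂ _ _ => exact absurd hb₂ hb
  | loop_step hb _ _ ih₁ ih₂ =>
    cases h₂ with
    | loop_done _ hb₂ => exact absurd hb hb₂
    | loop_step _ hp hl =>
      obtain ⟨rfl, rfl⟩ := ih₁ hp
      obtain ⟨rfl, rfl⟩ := ih₂ hl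
      exact ⟨rfl, rfl⟩

end RealRAM

namespace SparsePCA

/-- The unit vectors of `ℝ^N` with at most `K` nonzero entries. -/
def sparseSphere (N K : ℕ) : Set (EuclideanSpace ℝ (Fin N)) :=
  {x | ‖x‖ = 1 ∧ (Finset.univ.filter fun i => x i ≠ 0).card ≤ K}

/-- `x` is a `K`-sparse principal component of `C`: it maximizes `xᵀ C x` over the unit vectors
with at most `K` nonzero entries. -/
def IsSparsePC {N : ℕ} (C : Matrix (Fin N) (Fin N) ℝ) (K : ℕ) (x : EuclideanSpace ℝ (Fin N)) :
    Prop :=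
  x ∈ sparseSphere N K ∧
    IsMaxOn (fun y : EuclideanSpace ℝ (Fin N) => y.ofLp ⬝ᵥ C.mulVec y.ofLp) (sparseSphere N K) x

/-- The initial memory that presents the instance `(N, K, C)`: the numbers `N` and `K` are in the
cells `0` and `1` of the natural array `0`, the entries of `C` are in the real array `0`, and all
other cells are zero. -/
noncomputable def input {N : ℕ} (K : ℕ) (C : Matrix (Fin N) (Fin N) ℝ) : RealRAM.Memory where
  nat := fun a i => if a = 0 ∧ i = 0 then N else if a = 0 ∧ i = 1 then K else 0
  real := fun a i j => if h : a = 0 ∧ i < N ∧ j < N then C ⟨i, h.2.1⟩ ⟨j, h.2.2⟩ else 0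

/-- The vector that is read off from the cells `(0, 0), …, (N - 1, 0)` of the real array `1`. -/
noncomputable def output (N : ℕ) (m : RealRAM.Memory) : EuclideanSpace ℝ (Fin N) :=
  WithLp.toLp 2 fun i => m.real 1 i 0

end SparsePCA

/-! A multiple of the identity adds a constant to the quadratic form on the unit sphere, so only `A`
matters once a suitable shift has been found. If `N > D`, every principal block of `A` of size `D +
1` is singular, so `σ` is the smallest eigenvalue of the leading block of `C` of that size. If `N =
D`, any sufficiently negative shift leaves a positive definite matrix, again of rank `D`
(`exists_shift_eq`).

Let `y` be optimal for `A`, with value `q > 0`, and let `u = A y`. Among the sets with at most `K`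
elements let `S` maximize `∑ i ∈ S, u i ^ 2`, and let `x` be `u` restricted to `S`. Cauchy–Schwarz
and optimality give `(x - q y)ᵀ A (x - q y) ≤ 0`, so `A x = q u` and `x` is an eigenvector on `S`
for the value `q` (`exists_candidate`). It remains to list the sets of the `K` largest `|u i|`, for
`u` in the `D`-dimensional range of `A`.

For this, the threshold at `i` is perturbed to `1 + ε ^ (i + 1)`. The vectors of the range that are
above the thresholds, with given signs, exactly on `S` form a polyhedral cell. A vertex of the cell
meets the thresholds at `D` independent coordinates `I`, so it is determined by `I` and its signs
`s` there. Off `I` no ties occur for small `ε`, so the vertex tells which indices belong to `S`; on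
`I` membership is guessed, as a set `J` (`exists_candidate_support`). There are `O(N ^ D)` triples
`(I, s, J)`, and each is treated in time `O(N)`.

Let `B` be the invertible block of `A` on `I`, and `G` the Gram matrix of the columns `I` restricted
to `S`. Every positive root of `det (t B - G)` is the value of a unit vector supported in `S`
(`spread_value`), and `q` is the largest root for a suitable candidate. The size of these matrices
is fixed, so the root is one machine operation, and `exists_kernelVec` turns it into a vector by
finitely many formulas.

`Feasible` hides programs and running times. The loop rules quantify over invariants inside the
relation, so that a program is chosen before the instance while the invariants may mention the
unknown matrix `A`. -/

namespace RealRAM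

/-! ### Expressions, polynomials and tests that a program can evaluate -/

/-- A function of the memory that is the value of a real expression. -/
def IsExpr (f : Memory → ℝ) : Prop := ∃ e : RExpr, ∀ m, e.eval m = f m

/-- A polynomial function, depending on the memory, whose coefficients are values of real
expressions. -/
def IsPoly (f : Memory → ℝ → ℝ) : Prop :=
  ∃ cs : List RExpr, ∀ m t, polyVal (cs.map (RExpr.eval m)) t = f m t

/-- A property of the memory on which a program can branch in constant time. -/
def Decides (φ : Memory → Prop) : Prop :=
  ∃ k : ℕ, ∀ p q : Program, ∃ r : Program, ∀ m t m',
    (φ m → Runs p m t m' → ∃ t' ≤ t + k, Runs r m t' m') ∧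
    (¬ φ m → Runs q m t m' → ∃ t' ≤ t + k, Runs r m t' m')

/-- A program can transform the memory according to the relation `R`, in time `O((N + 1) ^ k)`,
where `N` is the content of the first natural cell. -/
def Feasible (k : ℕ) (R : Memory → Memory → Prop) : Prop :=
  ∃ (p : Program) (c : ℕ), ∀ m, ∃ t m', Runs p m t m' ∧ t ≤ c * (m.nat 0 0 + 1) ^ k ∧ R m m'

namespace IsExpr

variable {f g : Memory → ℝ}

theorem zero : IsExpr fun _ => 0 := ⟨.lit 0, fun _ => by simp [RExpr.eval]⟩

theorem one : IsExpr fun _ => 1 := ⟨.lit 1, fun _ => by simp [RExpr.eval]⟩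

theorem cell (a : ℕ) (i j : NExpr) : IsExpr fun m => m.real a (i.eval m) (j.eval m) :=
  ⟨.read a i j, fun _ => rfl⟩

theorem constCell (a i j : ℕ) : IsExpr fun m => m.real a i j := cell a (.lit i) (.lit j)

theorem add (hf : IsExpr f) (hg : IsExpr g) : IsExpr fun m => f m + g m := by
  obtain ⟨e, he⟩ := hf
  obtain ⟨e', he'⟩ := hg
  exact ⟨.add e e', fun m => by simp [RExpr.eval, he, he']⟩

theorem sub (hf : IsExpr f) (hg : IsExpr g) : IsExpr fun m => f m - g m := by
  obtain ⟨e, he⟩ := hf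
  obtain ⟨e', he'⟩ := hg
  exact ⟨.sub e e', fun m => by simp [RExpr.eval, he, he']⟩

theorem mul (hf : IsExpr f) (hg : IsExpr g) : IsExpr fun m => f m * g m := by
  obtain ⟨e, he⟩ := hf
  obtain ⟨e', he'⟩ := hg
  exact ⟨.mul e e', fun m => by simp [RExpr.eval, he, he']⟩

theorem div (hf : IsExpr f) (hg : IsExpr g) : IsExpr fun m => f m / g m := by
  obtain ⟨e, he⟩ := hf
  obtain ⟨e', he'⟩ := hg
  exact ⟨.div e e', fun m => by simp [RExpr.eval, he, he']⟩

theorem neg (hf : IsExpr f) : IsExpr fun m => - f m := by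
  simpa using zero.sub hf

theorem unit (u : ℤˣ) : IsExpr fun _ => ((u : ℤ) : ℝ) := by
  rcases Int.units_eq_one_or u with rfl | rfl
  · simpa using one
  · simpa using one.neg

theorem sum {ι : Type*} (s : Finset ι) {F : ι → Memory → ℝ} (h : ∀ i, IsExpr (F i)) :
    IsExpr fun m => ∑ i ∈ s, F i m := by
  classical
  induction s using Finset.induction_on with
  | empty => simpa using zero
  | insert i s hi ih => simpa [Finset.sum_insert hi] using (h i).add ih

theorem dotProduct {ι : Type*} [Fintype ι] {u v : Memory → ι → ℝ}
    (hu : ∀ i, IsExpr fun m => u m i) (hv : ∀ i, IsExpr fun m => v m i) :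
    IsExpr fun m => u m ⬝ᵥ v m := by
  simpa only [_root_.dotProduct] using sum Finset.univ fun i => (hu i).mul (hv i)

theorem mulVec {ι κ : Type*} [Fintype κ] {M : Memory → Matrix ι κ ℝ} {v : Memory → κ → ℝ}
    (hM : ∀ i j, IsExpr fun m => M m i j) (hv : ∀ i, IsExpr fun m => v m i) (i : ι) :
    IsExpr fun m => (M m).mulVec (v m) i :=
  dotProduct (hM i) hv

end IsExpr

theorem polyVal_nil (t : ℝ) : polyVal [] t = 0 := rfl

theorem polyVal_cons (c : ℝ) (cs : List ℝ) (t : ℝ) :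
    polyVal (c :: cs) t = c + t * polyVal cs t := rfl

theorem exists_polynomial (cs : List ℝ) :
    ∃ p : Polynomial ℝ, (∀ t, p.eval t = polyVal cs t) ∧ ∀ k, p.coeff k = cs.getD k 0 := by
  induction cs with
  | nil => exact ⟨0, by simp [polyVal_nil], by simp⟩
  | cons c cs ih =>
    obtain ⟨p, h1, h2⟩ := ih
    refine ⟨Polynomial.C c + Polynomial.X * p, fun t => by simp [polyVal_cons, h1], fun k => ?_⟩
    cases k with
    | zero => simp
    | succ k => simp [h2]

namespace IsPoly

variable {f g : Memory → ℝ → ℝ}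

theorem zero : IsPoly fun _ _ => 0 := ⟨[], fun _ _ => rfl⟩

theorem of_isExpr {f : Memory → ℝ} (hf : IsExpr f) : IsPoly fun m _ => f m := by
  obtain ⟨e, he⟩ := hf
  exact ⟨[e], fun m t => by simp [polyVal_cons, polyVal_nil, he]⟩

theorem id : IsPoly fun _ t => t :=
  ⟨[.lit 0, .lit 1], fun m t => by simp [polyVal_cons, polyVal_nil, RExpr.eval]⟩

theorem add (hf : IsPoly f) (hg : IsPoly g) : IsPoly fun m t => f m t + g m t := by
  obtain ⟨cs, hc⟩ := hf
  obtain ⟨ds, hd⟩ := hg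
  suffices h : IsPoly fun m t =>
      polyVal (cs.map (RExpr.eval m)) t + polyVal (ds.map (RExpr.eval m)) t by
    simpa only [hc, hd] using h
  clear hc hd
  induction cs generalizing ds with
  | nil => exact ⟨ds, fun m t => by simp [polyVal_nil]⟩
  | cons c cs ih =>
    cases ds with
    | nil => exact ⟨c :: cs, fun m t => by simp [polyVal_nil]⟩
    | cons d ds =>
      obtain ⟨es, he⟩ := ih ds
      exact ⟨.add c d :: es, fun m t => by simp [polyVal_cons, he, RExpr.eval]; ring⟩

theorem mul (hf : IsPoly f) (hg : IsPoly g) : IsPoly fun m t => f m t * g m t := by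
  obtain ⟨cs, hc⟩ := hf
  suffices h : IsPoly fun m t => polyVal (cs.map (RExpr.eval m)) t * g m t by
    simpa only [hc] using h
  clear hc
  induction cs with
  | nil => simpa [polyVal_nil] using zero
  | cons c cs ih =>
    have h1 : IsPoly fun m t => c.eval m * g m t := by
      obtain ⟨ds, hd⟩ := hg
      refine ⟨ds.map (RExpr.mul c), fun m t => ?_⟩
      simp only [← hd]
      clear hd
      induction ds with
      | nil => simp [polyVal_nil]
      | cons d ds ih => simp only [List.map_cons, polyVal_cons, ih, RExpr.eval]; ring
    have h2 : IsPoly fun m t => t * (polyVal (cs.map (RExpr.eval m)) t * g m t) := by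
      obtain ⟨es, he⟩ := ih
      exact ⟨.lit 0 :: es, fun m t => by simp [polyVal_cons, he, RExpr.eval]⟩
    convert h1.add h2 using 3
    simp only [List.map_cons, polyVal_cons]; ring

theorem sub (hf : IsPoly f) (hg : IsPoly g) : IsPoly fun m t => f m t - g m t := by
  convert hf.add ((of_isExpr IsExpr.one.neg).mul hg) using 3
  ring

theorem sum {ι : Type*} (s : Finset ι) {F : ι → Memory → ℝ → ℝ} (h : ∀ i, IsPoly (F i)) :
    IsPoly fun m t => ∑ i ∈ s, F i m t := by
  classical
  induction s using Finset.induction_on with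
  | empty => simpa using zero
  | insert i s hi ih => simpa [Finset.sum_insert hi] using (h i).add ih

theorem prod {ι : Type*} (s : Finset ι) {F : ι → Memory → ℝ → ℝ} (h : ∀ i, IsPoly (F i)) :
    IsPoly fun m t => ∏ i ∈ s, F i m t := by
  classical
  induction s using Finset.induction_on with
  | empty => simpa using of_isExpr IsExpr.one
  | insert i s hi ih => simpa [Finset.prod_insert hi] using (h i).mul ih

/-- The Leibniz formula has a number of terms that depends only on `n`, so it can be written out in
the text of the program. -/
theorem det {n : ℕ} {M : Memory → ℝ → Matrix (Fin n) (Fin n) ℝ}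
    (h : ∀ i j, IsPoly fun m t => M m t i j) : IsPoly fun m t => (M m t).det := by
  simp only [Matrix.det_apply']
  exact sum _ fun σ => (of_isExpr (IsExpr.unit _)).mul (prod _ fun i => h _ _)

theorem adjugate {n : ℕ} {M : Memory → ℝ → Matrix (Fin n) (Fin n) ℝ}
    (h : ∀ i j, IsPoly fun m t => M m t i j) (i j : Fin n) :
    IsPoly fun m t => (M m t).adjugate i j := by
  simp only [Matrix.adjugate_apply]
  refine det fun i' j' => ?_
  by_cases hi : i' = j
  · subst hi
    by_cases hj : j' = i
    · subst hj
      simpa using of_isExpr IsExpr.one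
    · simpa [Pi.single_apply, hj] using of_isExpr IsExpr.zero
  · simpa [Matrix.updateRow_apply, hi] using h i' j'

/-- At `t = 0` only the constant coefficient survives. This lets results on determinants and
adjugates over polynomials be reused for plain expressions. -/
theorem isExpr_const {f : Memory → ℝ} (h : IsPoly fun m _ => f m) : IsExpr f := by
  obtain ⟨cs, hc⟩ := h
  cases cs with
  | nil => exact ⟨.lit 0, fun m => by simp [← hc m 0, polyVal_nil, RExpr.eval]⟩
  | cons c cs => exact ⟨c, fun m => by simp [← hc m 0, polyVal_cons]⟩

end IsPoly

theorem IsExpr.det {n : ℕ} {M : Memory → Matrix (Fin n) (Fin n) ℝ}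
    (h : ∀ i j, IsExpr fun m => M m i j) : IsExpr fun m => (M m).det :=
  (IsPoly.det (M := fun m _ => M m) fun i j => .of_isExpr (h i j)).isExpr_const

/-- Cramer's rule. For a singular matrix both sides are zero by convention, so the determinant needs
no test. -/
theorem IsExpr.inv {n : ℕ} {M : Memory → Matrix (Fin n) (Fin n) ℝ}
    (h : ∀ i j, IsExpr fun m => M m i j) (i j : Fin n) : IsExpr fun m => (M m)⁻¹ i j := by
  convert ((IsPoly.adjugate (M := fun m _ => M m)
    (fun i j => .of_isExpr (h i j)) i j).isExpr_const).div (IsExpr.det h) using 2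
  simp [Matrix.inv_def]
  ring

namespace Decides

variable {φ ψ : Memory → Prop}

theorem of_test (b : Test) (h : ∀ m, b.Holds m ↔ φ m) : Decides φ :=
  ⟨b.cost, fun p q => ⟨.ite b p q, fun m t m' =>
    ⟨fun hm hp => ⟨b.cost + t, by omega, .ite_true q ((h m).2 hm) hp⟩,
     fun hm hq => ⟨b.cost + t, by omega, .ite_false p (fun hb => hm ((h m).1 hb)) hq⟩⟩⟩⟩

theorem natLt (e f : NExpr) : Decides fun m => e.eval m < f.eval m :=
  of_test (.natLt e f) fun _ => Iff.rfl

theorem lt {f g : Memory → ℝ} (hf : IsExpr f) (hg : IsExpr g) : Decides fun m => f m < g m := by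
  obtain ⟨e, he⟩ := hf
  obtain ⟨e', he'⟩ := hg
  exact of_test (.realLt e e') fun m => by simp [Test.Holds, he, he']

theorem not (h : Decides φ) : Decides fun m => ¬ φ m := by
  obtain ⟨k, hk⟩ := h
  refine ⟨k, fun p q => ?_⟩
  obtain ⟨r, hr⟩ := hk q p
  exact ⟨r, fun m t m' => ⟨(hr m t m').2, fun hm => (hr m t m').1 (not_not.1 hm)⟩⟩

theorem and (h : Decides φ) (h' : Decides ψ) : Decides fun m => φ m ∧ ψ m := by
  obtain ⟨k, hk⟩ := h
  obtain ⟨k', hk'⟩ := h'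
  refine ⟨k + k', fun p q => ?_⟩
  obtain ⟨r', hr'⟩ := hk' p q
  obtain ⟨r, hr⟩ := hk r' q
  refine ⟨r, fun m t m' => ⟨fun hm hp => ?_, fun hm hq => ?_⟩⟩
  · obtain ⟨t', ht', h'⟩ := (hr' m t m').1 hm.2 hp
    obtain ⟨t'', ht'', h''⟩ := (hr m t' m').1 hm.1 h'
    exact ⟨t'', by omega, h''⟩
  · by_cases h1 : φ m
    · obtain ⟨t', ht', h'⟩ := (hr' m t m').2 (fun h2 => hm ⟨h1, h2⟩) hq
      obtain ⟨t'', ht'', h''⟩ := (hr m t' m').1 h1 h'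
      exact ⟨t'', by omega, h''⟩
    · obtain ⟨t'', ht'', h''⟩ := (hr m t m').2 h1 hq
      exact ⟨t'', by omega, h''⟩

theorem or (h : Decides φ) (h' : Decides ψ) : Decides fun m => φ m ∨ ψ m := by
  simpa only [not_and_or, not_not] using (h.not.and h'.not).not

theorem false : Decides fun _ => False :=
  of_test (.natLt (.lit 0) (.lit 0)) fun m => by simp [Test.Holds]

theorem eq {f g : Memory → ℝ} (hf : IsExpr f) (hg : IsExpr g) : Decides fun m => f m = g m := by
  convert (lt hf hg).not.and (lt hg hf).not using 2 with m
  rw [not_lt, not_lt, and_comm]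
  exact le_antisymm_iff

theorem natEq (e f : NExpr) : Decides fun m => e.eval m = f.eval m := by
  convert (natLt e f).not.and (natLt f e).not using 2 with m
  rw [not_lt, not_lt, and_comm]
  exact le_antisymm_iff

theorem exists_mem {ι : Type*} (s : Finset ι) {Φ : ι → Memory → Prop} (h : ∀ i, Decides (Φ i)) :
    Decides fun m => ∃ i ∈ s, Φ i m := by
  classical
  induction s using Finset.induction_on with
  | empty => simpa using false
  | insert i s hi ih => simpa [Finset.exists_mem_insert] using (h i).or ih

theorem forall_mem {ι : Type*} (s : Finset ι) {Φ : ι → Memory → Prop} (h : ∀ i, Decides (Φ i)) :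
    Decides fun m => ∀ i ∈ s, Φ i m := by
  simpa using (exists_mem s fun i => (h i).not).not

end Decides

/-! ### Programs -/

namespace Feasible

variable {k l : ℕ} {R R' : Memory → Memory → Prop}

theorem imp (h : Feasible k R) (hR : ∀ m m', R m m' → R' m m') : Feasible k R' := by
  obtain ⟨p, c, hp⟩ := h
  refine ⟨p, c, fun m => ?_⟩
  obtain ⟨t, m', h1, h2, h3⟩ := hp m
  exact ⟨t, m', h1, h2, hR _ _ h3⟩

theorem mono (h : Feasible k R) (hkl : k ≤ l) : Feasible l R := by
  obtain ⟨p, c, hp⟩ := h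
  refine ⟨p, c, fun m => ?_⟩
  obtain ⟨t, m', h1, h2, h3⟩ := hp m
  exact ⟨t, m', h1, h2.trans (Nat.mul_le_mul_left c (Nat.pow_le_pow_right (by omega) hkl)), h3⟩

theorem skip : Feasible 0 fun m m' => m' = m :=
  ⟨.skip, 1, fun m => ⟨1, m, .skip m, by simp, rfl⟩⟩

theorem setNat (a : ℕ) (i e : NExpr) :
    Feasible 0 fun m m' => m' = m.storeNat a (i.eval m) (e.eval m) :=
  ⟨_, _, fun m => ⟨_, _, .setNat a i e m, by rw [pow_zero, mul_one], rfl⟩⟩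

theorem setReal (a : ℕ) (i j : NExpr) {f : Memory → ℝ} (hf : IsExpr f) :
    Feasible 0 fun m m' => m' = m.storeReal a (i.eval m) (j.eval m) (f m) := by
  obtain ⟨e, he⟩ := hf
  exact ⟨_, _, fun m => ⟨_, _, .setReal a i j e m, by rw [pow_zero, mul_one], by rw [he]⟩⟩

theorem setConst (a i j : ℕ) {f : Memory → ℝ} (hf : IsExpr f) :
    Feasible 0 fun m m' => m' = m.storeReal a i j (f m) :=
  setReal a (.lit i) (.lit j) hf

theorem setRoot (a i j : ℕ) {f : Memory → ℝ → ℝ} (hf : IsPoly f) :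
    Feasible 0 fun m m' => m' = m.storeReal a i j (sSup {t | f m t = 0}) := by
  obtain ⟨cs, hc⟩ := hf
  exact ⟨_, _, fun m => ⟨_, _, .setRoot a (.lit i) (.lit j) cs m, by rw [pow_zero, mul_one], by
    simp only [largestRoot, hc, NExpr.eval]⟩⟩

/-- The second time bound refers to the memory in which the second program starts; it is a bound in
the original `N` only because the first program preserves that cell. -/
theorem seq (h : Feasible k R) (h' : Feasible k R')
    (hR : ∀ m m', R m m' → m'.nat 0 0 = m.nat 0 0) :
    Feasible k fun m m' => ∃ m₁, R m m₁ ∧ R' m₁ m' := by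
  obtain ⟨p, c, hp⟩ := h
  obtain ⟨q, d, hq⟩ := h'
  refine ⟨.seq p q, c + d, fun m => ?_⟩
  obtain ⟨t, m₁, h1, h2, h3⟩ := hp m
  obtain ⟨t', m', h1', h2', h3'⟩ := hq m₁
  rw [hR _ _ h3] at h2'
  exact ⟨t + t', m', .seq h1 h1', by rw [add_mul]; omega, m₁, h3, h3'⟩

theorem ite {φ : Memory → Prop} (hφ : Decides φ) (h : Feasible k R) (h' : Feasible k R') :
    Feasible k fun m m' => (φ m → R m m') ∧ (¬ φ m → R' m m') := by
  obtain ⟨p, c, hp⟩ := h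
  obtain ⟨q, d, hq⟩ := h'
  obtain ⟨e, he⟩ := hφ
  obtain ⟨r, hr⟩ := he p q
  refine ⟨r, c + d + e, fun m => ?_⟩
  have hpos : 1 ≤ (m.nat 0 0 + 1) ^ k := Nat.one_le_pow _ _ (by omega)
  by_cases hm : φ m
  · obtain ⟨t, m₁, h1, h2, h3⟩ := hp m
    obtain ⟨t', ht', h4⟩ := (hr m t m₁).1 hm h1
    exact ⟨t', m₁, h4, by nlinarith, fun _ => h3, fun h => absurd hm h⟩
  · obtain ⟨t, m₁, h1, h2, h3⟩ := hq m
    obtain ⟨t', ht', h4⟩ := (hr m t m₁).2 hm h1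
    exact ⟨t', m₁, h4, by nlinarith, fun h => absurd h hm, fun _ => h3⟩

/-- Running programs for all members of a list. `Inv` is an invariant, and `Done x` is a property
established by the program for `x` and preserved by all of them. -/
theorem list {ι : Type*} (xs : List ι) {R : ι → Memory → Memory → Prop}
    (h : ∀ x, Feasible k (R x)) (hR : ∀ x m m', R x m m' → m'.nat 0 = m.nat 0) :
    Feasible k fun m m' => m'.nat 0 = m.nat 0 ∧
      ∀ (Inv : Memory → Prop) (Done : ι → Memory → Prop),
        (∀ x m₁ m₂, x ∈ xs → Inv m₁ → R x m₁ m₂ →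
          Inv m₂ ∧ Done x m₂ ∧ ∀ y, Done y m₁ → Done y m₂) →
        Inv m → Inv m' ∧ (∀ y, Done y m → Done y m') ∧ ∀ x ∈ xs, Done x m' := by
  induction xs with
  | nil =>
    refine (skip.mono (Nat.zero_le k)).imp ?_
    rintro m _ rfl
    exact ⟨rfl, fun Inv Done _ hi => ⟨hi, fun _ => id, by simp⟩⟩
  | cons x xs ih =>
    refine ((h x).seq ih fun m m' hm => by rw [hR x m m' hm]).imp ?_
    rintro m m' ⟨m₁, h1, h2, h3⟩
    refine ⟨h2.trans (hR x _ _ h1), fun Inv Done hs hi => ?_⟩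
    obtain ⟨i1, d1, p1⟩ := hs x m m₁ (by simp) hi h1
    obtain ⟨i2, p2, d2⟩ := h3 Inv Done (fun y a b hy => hs y a b (by simp [hy])) i1
    refine ⟨i2, fun y hy => p2 y (p1 y hy), fun y hy => ?_⟩
    rcases List.mem_cons.1 hy with rfl | hy
    · exact p2 _ d1
    · exact d2 y hy

/-- Counting loops, with the counter in the natural cell `(a, x)`. -/
theorem forLoop (a x : ℕ) (ha : a ≠ 0) (h : Feasible k R)
    (hR : ∀ m m', R m m' → m'.nat 0 = m.nat 0 ∧ m'.nat a x = m.nat a x) :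
    Feasible (k + 1) fun m m' => m'.nat 0 = m.nat 0 ∧
      ∀ Inv : ℕ → Memory → Prop,
        (∀ j m₁ m₂, j < m.nat 0 0 → m₁.nat 0 = m.nat 0 → m₁.nat a x = j → Inv j m₁ → R m₁ m₂ →
          Inv (j + 1) (m₂.storeNat a x (j + 1))) →
        Inv 0 (m.storeNat a x 0) → Inv (m.nat 0 0) m' := by
  obtain ⟨p, c, hp⟩ := h
  let b : Test := .natLt (.read a (.lit x)) (.read 0 (.lit 0))
  let inc : Program := .setNat a (.lit x) (.add (.read a (.lit x)) (.lit 1))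
  -- Induction on the number `r` of remaining rounds. The slack of 20 covers the test (5 units) and
  -- the increment (6 units).
  have key : ∀ (r j : ℕ) (m : Memory), j + r = m.nat 0 0 → m.nat a x = j →
      ∃ t m', Runs (.loop b (.seq p inc)) m t m' ∧ t ≤ r * (c * (m.nat 0 0 + 1) ^ k + 20) + 20 ∧
        m'.nat 0 = m.nat 0 ∧ ∀ Inv : ℕ → Memory → Prop,
        (∀ j m₁ m₂, j < m.nat 0 0 → m₁.nat 0 = m.nat 0 → m₁.nat a x = j → Inv j m₁ → R m₁ m₂ →
          Inv (j + 1) (m₂.storeNat a x (j + 1))) → Inv j m → Inv (m.nat 0 0) m' := by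
    intro r
    induction r with
    | zero =>
      intro j m hj hx
      refine ⟨_, m, .loop_done _ ?_, ?_, rfl, ?_⟩
      · simp [b, Test.Holds, NExpr.eval, hx]; omega
      · simp [b, Test.cost, NExpr.cost]
      · intro Inv _ hi
        rwa [← hj]
    | succ r ih =>
      intro j m hj hx
      obtain ⟨t, m₁, h1, h2, h3⟩ := hp m
      obtain ⟨h4, h5⟩ := hR _ _ h3
      set m₂ := m₁.storeNat a x (j + 1) with hm₂
      have h6 : m₂.nat 0 = m.nat 0 := by
        funext i
        simp [hm₂, Memory.storeNat, Ne.symm ha, h4]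
      have h7 : Runs inc m₁ 6 m₂ := by
        have := Runs.setNat a (.lit x) (.add (.read a (.lit x)) (.lit 1)) m₁
        simpa [NExpr.eval, NExpr.cost, h5, hx, hm₂] using this
      obtain ⟨t', m', g1, g2, g3, g4⟩ := ih (j + 1) m₂ (by rw [h6]; omega)
        (by simp [hm₂, Memory.storeNat])
      refine ⟨_, m', .loop_step ?_ (.seq h1 h7) g1, ?_, g3.trans h6, ?_⟩
      · simp [b, Test.Holds, NExpr.eval, hx]; omega
      · rw [h6] at g2
        have : b.cost = 5 := rfl
        rw [this, add_mul]
        omega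
      · intro Inv hs hi
        rw [h6] at g4
        exact g4 Inv hs (hs j m m₁ (by omega) rfl hx hi h3)
  refine ⟨.seq (.setNat a (.lit x) (.lit 0)) (.loop b (.seq p inc)), c + 50, fun m => ?_⟩
  have hst : (m.storeNat a x 0).nat 0 = m.nat 0 := by
    funext i
    simp [Memory.storeNat, Ne.symm ha]
  obtain ⟨t, m', h1, h2, h3, h4⟩ := key (m.nat 0 0) 0 (m.storeNat a x 0) (by rw [hst]; simp)
    (by simp [Memory.storeNat])
  rw [hst] at h2 h3 h4
  refine ⟨_, m', .seq (.setNat a (.lit x) (.lit 0) m) h1, ?_, h3, fun Inv hs hi => h4 Inv hs hi⟩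
  simp only [NExpr.cost]
  have hpos : 1 ≤ (m.nat 0 0 + 1) ^ k := Nat.one_le_pow _ _ (by omega)
  rw [pow_succ]
  nlinarith [Nat.zero_le (c * (m.nat 0 0 + 1) ^ k), Nat.zero_le (m.nat 0 0)]

/-- Nested counting loops, with the counters in the first `d` cells of the natural array `1`. -/
theorem nest (d : ℕ) (h : Feasible k R)
    (hR : ∀ m m', R m m' → m'.nat 0 = m.nat 0 ∧ m'.nat 1 = m.nat 1) :
    Feasible (k + d) fun m m' => m'.nat 0 = m.nat 0 ∧ (∀ e, d ≤ e → m'.nat 1 e = m.nat 1 e) ∧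
      ∀ (Inv : Memory → Prop) (Done : (ℕ → ℕ) → Memory → Prop),
        (∀ m e v, Inv m → Inv (m.storeNat 1 e v)) →
        (∀ I m e v, Done I m → Done I (m.storeNat 1 e v)) →
        (∀ m₁ m₂, (∀ e, e < d → m₁.nat 1 e < m.nat 0 0) →
          (∀ e, d ≤ e → m₁.nat 1 e = m.nat 1 e) → Inv m₁ → R m₁ m₂ →
          Inv m₂ ∧ Done (m₁.nat 1) m₂ ∧ ∀ I, Done I m₁ → Done I m₂) →
        Inv m → Inv m' ∧ (∀ I, Done I m → Done I m') ∧
          ∀ I : ℕ → ℕ, (∀ e, e < d → I e < m.nat 0 0) → (∀ e, d ≤ e → I e = m.nat 1 e) →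
            Done I m' := by
  induction d with
  | zero =>
    refine h.imp fun m m' hm => ⟨(hR _ _ hm).1, fun e _ => by rw [(hR _ _ hm).2], ?_⟩
    intro Inv Done _ _ hs hi
    obtain ⟨h1, h2, h3⟩ := hs m m' (by simp) (by simp) hi hm
    exact ⟨h1, h3, fun I _ hI => by rwa [show I = m.nat 1 from funext fun e => hI e (by simp)]⟩
  | succ d ih =>
    refine (forLoop 1 d one_ne_zero ih fun m m' hm => ⟨hm.1, hm.2.1 d le_rfl⟩).imp ?_
    rintro m m' ⟨h0, hl⟩
    refine ⟨h0, fun e he => ?_, fun Inv Done si sd hs hi => ?_⟩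
    · refine hl (fun _ m₁ => m₁.nat 1 e = m.nat 1 e) ?_ ?_
      · intro j m₁ m₂ _ _ _ h1 h2
        have : e ≠ d := by omega
        simp [Memory.storeNat, this, h2.2.1 e (by omega), h1]
      · have : e ≠ d := by omega
        simp [Memory.storeNat, this]
    -- The new counter `d` is the outermost one: before round `j`, the tuples with entry less than
    -- `j` at `d` are done. Entries beyond `d` are fixed to their initial values, which the
    -- induction hypothesis for the inner loops requires.
    · have := hl (fun j m₁ => (∀ e, d + 1 ≤ e → m₁.nat 1 e = m.nat 1 e) ∧ Inv m₁ ∧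
        (∀ I, Done I m → Done I m₁) ∧ ∀ I : ℕ → ℕ, (∀ e, e < d → I e < m.nat 0 0) → I d < j →
          (∀ e, d + 1 ≤ e → I e = m.nat 1 e) → Done I m₁) ?_ ?_
      · refine ⟨this.2.1, this.2.2.1, fun I hI hI' => this.2.2.2 I (fun e he => hI e (by omega))
          (hI d (by omega)) hI'⟩
      · rintro j m₁ m₂ hj hm₁ hx ⟨i1, i2, i3, i4⟩ ⟨_, r2, r3⟩
        obtain ⟨s1, s2, s3⟩ := r3 Inv Done si sd (by
          intro n₁ n₂ hn1 hn2
          rw [hm₁] at hn1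
          refine hs n₁ n₂ (fun e he => ?_) fun e he => ?_
          · rcases Nat.lt_succ_iff_lt_or_eq.1 he with he | rfl
            · exact hn1 e he
            · rwa [hn2 _ le_rfl, hx]
          · rw [hn2 e (by omega), i1 e he]) i2
        refine ⟨fun e he => ?_, si _ _ _ s1, fun I hI => sd _ _ _ _ (s2 I (i3 I hI)), ?_⟩
        · have : e ≠ d := by omega
          simp [Memory.storeNat, this, r2 e (by omega), i1 e he]
        · intro I hI hd hI'
          refine sd _ _ _ _ ?_
          rcases Nat.lt_succ_iff_lt_or_eq.1 hd with hd | hd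
          · exact s2 I (i4 I hI hd hI')
          · refine s3 I (by rwa [hm₁]) fun e he => ?_
            rcases Nat.eq_or_lt_of_le he with rfl | he
            · rw [hd, hx]
            · rw [hI' e he, i1 e he]
      · refine ⟨fun e he => ?_, si _ _ _ hi, fun I hI => sd _ _ _ _ hI, fun I _ h => by omega⟩
        have : e ≠ d := by omega
        simp [Memory.storeNat, this]

end Feasible

end RealRAM

/-! ### Candidate supports -/

namespace SparsePCA

open Matrix Finset Filter Topology

variable {D N : ℕ}

/-- The square block of `E` with rows and columns `I`. -/
def block {ι : Type*} (E : Matrix ι ι ℝ) (I : Fin D → ι) : Matrix (Fin D) (Fin D) ℝ :=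
  .of fun a b => E (I a) (I b)

/-- The entries of the row `i` of `E` in the columns `I`. -/
def row {ι : Type*} (E : Matrix ι ι ℝ) (I : Fin D → ι) (i : ι) : Fin D → ℝ := fun a => E i (I a)

/-- The coefficients of the row `i` as a combination of the rows `I`. -/
noncomputable def coord {ι : Type*} (E : Matrix ι ι ℝ) (I : Fin D → ι) (i : ι) : Fin D → ℝ :=
  (block E I)⁻¹ *ᵥ row E I i

/-- The sign at a small positive `ε` of `∑ a j (1 + ε ^ (I j + 1)) - (1 + ε ^ (i + 1))`. -/
def LexPos {ι : Type*} [LT ι] (I : Fin D → ι) (i : ι) (a : Fin D → ℝ) : Prop :=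
  1 < ∑ j, a j ∨ (∑ j, a j = 1 ∧ ∃ j, I j < i ∧ 0 < a j ∧ ∀ l, l < j → a l = 0)

/-- Membership in the candidate support: the indices at which the vector in the range of `E` with
the entries `s j` at `I j` has absolute value more than one, where ties are broken by an
infinitesimal perturbation, together with the indices `I j` for `j ∈ J`. -/
def Member {ι : Type*} [LT ι] (E : Matrix ι ι ℝ) (I : Fin D → ι) (s : Fin D → ℤˣ)
    (J : Finset (Fin D)) (i : ι) : Prop :=
  (∃ j ∈ J, I j = i) ∨ ((∀ j, I j ≠ i) ∧
    (LexPos I i (fun j => ((s j : ℤ) : ℝ) * coord E I i j) ∨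
      LexPos I i (fun j => -(((s j : ℤ) : ℝ) * coord E I i j))))

/-- The Gram matrix of the columns `I` of `E`, restricted to the rows in `S`. -/
def gram {ι : Type*} (E : Matrix ι ι ℝ) (I : Fin D → ι) (S : Finset ι) :
    Matrix (Fin D) (Fin D) ℝ :=
  .of fun a b => ∑ i ∈ S, row E I i a * row E I i b

/-- The largest generalized eigenvalue of the Gram matrix. -/
noncomputable def topRoot {ι : Type*} (E : Matrix ι ι ℝ) (I : Fin D → ι) (S : Finset ι) : ℝ :=
  sSup {t : ℝ | (t • block E I - gram E I S).det = 0}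

/-- The vector with support in `S` given by a combination of columns of `E`. -/
noncomputable def spread {ι : Type*} (E : Matrix ι ι ℝ) (I : Fin D → ι) (S : Finset ι)
    (z : Fin D → ℝ) (i : ι) : ℝ :=
  open Classical in if i ∈ S then row E I i ⬝ᵥ z else 0

/-! ### Signs of polynomials at small positive arguments -/

section Perturbation

/-- Near zero on the right, the lowest nonzero coefficient decides the sign: after division by `X ^
k` it is the value at zero. -/
theorem eventually_eval_pos (p : Polynomial ℝ) (k : ℕ) (hk : 0 < p.coeff k)
    (h : ∀ l, l < k → p.coeff l = 0) : ∀ᶠ ε in 𝓝[>] (0 : ℝ), 0 < p.eval ε := by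
  obtain ⟨q, rfl⟩ := Polynomial.X_pow_dvd_iff.2 h
  have h0 : 0 < q.eval 0 := by
    rw [← Polynomial.coeff_zero_eq_eval_zero]
    simpa [Polynomial.coeff_X_pow_mul'] using hk
  have h1 : ∀ᶠ ε in 𝓝[>] (0 : ℝ), 0 < q.eval ε :=
    (q.continuous.continuousAt.eventually_const_lt h0).filter_mono nhdsWithin_le_nhds
  filter_upwards [h1, self_mem_nhdsWithin] with ε h2 h3
  have : 0 < ε := h3
  simp only [Polynomial.eval_mul, Polynomial.eval_pow, Polynomial.eval_X]
  positivity

/-- The difference of the two sides is a polynomial in `ε` with constant coefficient `∑ a j - 1`,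
coefficient `a j` in degree `I j + 1`, and `-1` in degree `i + 1`. These degrees are distinct, so
the polynomial is never zero and ties are impossible; `LexPos` says that its lowest nonzero
coefficient is positive. -/
theorem eventually_lexPos (I : Fin D → Fin N) (hI : StrictMono I) (i : Fin N)
    (hi : ∀ j, I j ≠ i) (a : Fin D → ℝ) :
    ∀ᶠ ε in 𝓝[>] (0 : ℝ),
      (LexPos I i a → 1 + ε ^ (i.val + 1) < ∑ j, a j * (1 + ε ^ ((I j).val + 1))) ∧
      (¬ LexPos I i a → ∑ j, a j * (1 + ε ^ ((I j).val + 1)) < 1 + ε ^ (i.val + 1)) := by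
  let p : Polynomial ℝ := ∑ j, Polynomial.C (a j) * (1 + Polynomial.X ^ ((I j).val + 1)) -
    (1 + Polynomial.X ^ (i.val + 1))
  have heval : ∀ ε, p.eval ε = ∑ j, a j * (1 + ε ^ ((I j).val + 1)) - (1 + ε ^ (i.val + 1)) := by
    intro ε
    simp [p, Polynomial.eval_finsetSum]
  have hc0 : p.coeff 0 = ∑ j, a j - 1 := by
    simp [p]
  have hc : ∀ l, p.coeff (l + 1) = (∑ j, if l = (I j).val then a j else 0) -
      if l = i.val then 1 else 0 := by
    intro l
    simp [p, Polynomial.coeff_one, Polynomial.coeff_X_pow]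
  have hcI : ∀ j, p.coeff ((I j).val + 1) = a j := by
    intro j
    have h1 : ∀ j', ((I j).val = (I j').val) ↔ j = j' := fun j' => by
      rw [← Fin.ext_iff, hI.injective.eq_iff]
    have h2 : (I j).val ≠ i.val := fun h => hi j (Fin.ext h)
    rw [hc]
    simp [h1, h2]
  have hlow : ∀ (m : Fin N), m ≤ i → (∑ j, a j = 1) → (∀ j, I j < m → a j = 0) →
      ∀ l, l < m.val + 1 → p.coeff l = 0 := by
    intro m hm hsum hz l hl
    cases l with
    | zero => rw [hc0, hsum, sub_self]
    | succ l =>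
      have h1 : l ≠ i.val := by
        have : m.val ≤ i.val := hm
        omega
      rw [hc, if_neg h1, sub_zero]
      refine Finset.sum_eq_zero fun j _ => ?_
      split_ifs with h
      · exact hz j (Fin.lt_def.2 (by omega))
      · rfl
  have hpos : ∀ k, 0 < p.coeff k → (∀ l, l < k → p.coeff l = 0) → ∀ᶠ ε in 𝓝[>] (0 : ℝ),
      1 + ε ^ (i.val + 1) < ∑ j, a j * (1 + ε ^ ((I j).val + 1)) := by
    intro k h1 h2
    filter_upwards [eventually_eval_pos p k h1 h2] with ε hε
    rw [heval] at hε
    linarith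
  have hneg : ∀ k, p.coeff k < 0 → (∀ l, l < k → p.coeff l = 0) → ∀ᶠ ε in 𝓝[>] (0 : ℝ),
      ∑ j, a j * (1 + ε ^ ((I j).val + 1)) < 1 + ε ^ (i.val + 1) := by
    intro k h1 h2
    filter_upwards [eventually_eval_pos (-p) k (by simpa using h1)
      (fun l hl => by simpa using h2 l hl)] with ε hε
    rw [Polynomial.eval_neg, heval] at hε
    linarith
  by_cases hL : LexPos I i a
  · suffices h : ∀ᶠ ε in 𝓝[>] (0 : ℝ),
        1 + ε ^ (i.val + 1) < ∑ j, a j * (1 + ε ^ ((I j).val + 1)) by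
      filter_upwards [h] with ε hε using ⟨fun _ => hε, fun h => absurd hL h⟩
    rcases hL with h | ⟨h1, j, hj, haj, hl⟩
    · exact hpos 0 (by rw [hc0]; linarith) (by simp)
    · refine hpos ((I j).val + 1) (by rwa [hcI]) (hlow _ hj.le h1 fun l h => hl l ?_)
      exact hI.lt_iff_lt.1 h
  · suffices h : ∀ᶠ ε in 𝓝[>] (0 : ℝ),
        ∑ j, a j * (1 + ε ^ ((I j).val + 1)) < 1 + ε ^ (i.val + 1) by
      filter_upwards [h] with ε hε using ⟨fun h => absurd h hL, fun _ => hε⟩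
    unfold LexPos at hL
    push Not at hL
    rcases hL.1.lt_or_eq with h | h
    · exact hneg 0 (by rw [hc0]; linarith) (by simp)
    by_cases hex : ∃ j, I j < i ∧ a j ≠ 0
    · classical
      obtain ⟨j, hj, hmin⟩ := Finset.exists_min_image
        (Finset.univ.filter fun j => I j < i ∧ a j ≠ 0) _root_.id
        (by obtain ⟨j, hj⟩ := hex; exact ⟨j, by simpa using hj⟩)
      simp only [Finset.mem_filter, Finset.mem_univ, true_and, _root_.id] at hj hmin
      have hz : ∀ l, l < j → a l = 0 := by
        intro l hl
        by_contra hne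
        exact absurd (hmin l ⟨(hI hl).trans hj.1, hne⟩) (not_le.2 hl)
      have haj : a j < 0 := by
        rcases lt_trichotomy (a j) 0 with h1 | h1 | h1
        · exact h1
        · exact absurd h1 hj.2
        · obtain ⟨l, hl, hne⟩ := hL.2 h j hj.1 h1
          exact absurd (hz l hl) hne
      exact hneg ((I j).val + 1) (by rwa [hcI])
        (hlow _ hj.1.le h fun l hl => hz l (hI.lt_iff_lt.1 hl))
    · push Not at hex
      -- All coefficients below degree `i + 1` vanish, so the coefficient `-1` decides.
      refine hneg (i.val + 1) ?_ (hlow i le_rfl h hex)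
      have h1 : ∀ j, i.val ≠ (I j).val := fun j h => hi j (Fin.ext h.symm)
      rw [hc]
      simp [h1]

end Perturbation

/-! ### The largest entries of a vector -/

section Selection

/-- Greedy choice, by induction on `K`. Zero entries are never added, which keeps the threshold
positive, as later rescaling by its inverse requires; the price is that `S` may have fewer than `K`
elements when only zeros are left. -/
theorem exists_top {ι : Type*} [Fintype ι] (r : ι → ℝ) (hr : ∀ i, 0 ≤ r i) (K : ℕ) :
    ∃ (S : Finset ι) (ρ : ℝ), 0 < ρ ∧ S.card ≤ K ∧ (∀ i ∈ S, ρ ≤ r i) ∧ (∀ i ∉ S, r i ≤ ρ) ∧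
      (S.card = K ∨ ∀ i ∉ S, r i = 0) := by
  classical
  induction K with
  | zero =>
    refine ⟨∅, ∑ i, r i + 1, ?_, by simp, by simp, fun i _ => ?_, by simp⟩
    · have := Finset.sum_nonneg fun i (_ : i ∈ Finset.univ) => hr i
      linarith
    · have := Finset.single_le_sum (fun i _ => hr i) (Finset.mem_univ i)
      linarith
  | succ K ih =>
    obtain ⟨S, ρ, hρ, hc, hin, hout, hor⟩ := ih
    by_cases hz : ∀ i ∉ S, r i = 0
    · exact ⟨S, ρ, hρ, by omega, hin, hout, .inr hz⟩
    have hcard := hor.resolve_right hz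
    push Not at hz
    obtain ⟨i₀, hi₀, hne⟩ := hz
    obtain ⟨i, hi, hmax⟩ := Finset.exists_max_image Sᶜ r ⟨i₀, by simpa using hi₀⟩
    have hpos : 0 < r i := lt_of_lt_of_le (lt_of_le_of_ne (hr i₀) (Ne.symm hne))
      (hmax i₀ (by simpa using hi₀))
    rw [Finset.mem_compl] at hi
    refine ⟨insert i S, r i, hpos, ?_, ?_, ?_, .inl ?_⟩
    · rw [Finset.card_insert_of_notMem hi, hcard]
    · intro j hj
      rcases Finset.mem_insert.1 hj with rfl | hj
      · exact le_rfl
      · exact (hout i hi).trans (hin j hj)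
    · intro j hj
      exact hmax j (by simpa using fun h => hj (Finset.mem_insert_of_mem h))
    · rw [Finset.card_insert_of_notMem hi, hcard]

/-- The common part cancels. Either `T \ S` has at most as many terms as `S \ T`, each bounded by
every term there, or its terms are all zero. -/
theorem sum_le_sum_of_top {ι : Type*} [DecidableEq ι] (S T : Finset ι) (f : ι → ℝ)
    (hf : ∀ i, 0 ≤ f i) (h : ∀ i ∈ S, ∀ j ∉ S, f j ≤ f i)
    (hc : T.card ≤ S.card ∨ ∀ i ∉ S, f i = 0) : ∑ i ∈ T, f i ≤ ∑ i ∈ S, f i := by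
  rw [← Finset.sum_inter_add_sum_sdiff T S, ← Finset.sum_inter_add_sum_sdiff S T,
    Finset.inter_comm S T]
  refine add_le_add le_rfl ?_
  rcases hc with hc | hc
  · rcases (T \ S).eq_empty_or_nonempty with he | he
    · rw [he, Finset.sum_empty]
      exact Finset.sum_nonneg fun i _ => hf i
    · obtain ⟨j, hj, hmax⟩ := Finset.exists_max_image (T \ S) f he
      have hcard : (T \ S).card ≤ (S \ T).card := by
        have h1 := Finset.card_sdiff_add_card_inter T S
        have h2 := Finset.card_sdiff_add_card_inter S T
        rw [Finset.inter_comm S T] at h2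
        omega
      calc ∑ i ∈ T \ S, f i ≤ (T \ S).card • f j := Finset.sum_le_card_nsmul _ _ _ hmax
        _ ≤ (S \ T).card • f j := nsmul_le_nsmul_left (hf j) hcard
        _ ≤ ∑ i ∈ S \ T, f i := Finset.card_nsmul_le_sum _ _ _ fun i hi =>
          h i (Finset.mem_sdiff.1 hi).1 j (Finset.mem_sdiff.1 hj).2
  · rw [Finset.sum_eq_zero fun i hi => hc i (Finset.mem_sdiff.1 hi).2]
    exact Finset.sum_nonneg fun i _ => hf i

end Selection

/-! ### Vertices of cells -/

section Vertex

/-- The vectors that are at least `θ` in absolute value, with prescribed signs, on `S`, and at most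
`θ` in absolute value off `S`. -/
def InCell (θ σ : Fin N → ℝ) (S : Finset (Fin N)) (v : Fin N → ℝ) : Prop :=
  (∀ i ∈ S, θ i ≤ σ i * v i) ∧ ∀ i ∉ S, |v i| ≤ θ i

/-- Move from `v` along `w` until the last moment at which the point is in the cell. There some
moving coordinate must be tight, since otherwise the motion could continue. -/
theorem InCell.exists_tight {θ σ : Fin N → ℝ} (hθ : ∀ i, 0 < θ i) (hσ : ∀ i, |σ i| = 1)
    {S : Finset (Fin N)} {v w : Fin N → ℝ} (hv : InCell θ σ S v)
    (hw : ∀ i, |v i| = θ i → w i = 0) (h0 : w ≠ 0) :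
    ∃ t : ℝ, InCell θ σ S (v + t • w) ∧ ∃ i, w i ≠ 0 ∧ |(v + t • w) i| = θ i := by
  obtain ⟨i₀, hi₀⟩ := Function.ne_iff.1 h0
  -- On `S` the cell has only a lower bound, so the direction is chosen to decrease `σ i₀ * v i₀`
  -- and thus to leave the cell. Off `S` both directions leave it.
  wlog hsgn : i₀ ∈ S → σ i₀ * w i₀ < 0 generalizing w with H
  · push Not at hsgn
    have h1 : 0 < σ i₀ * w i₀ := lt_of_le_of_ne hsgn.2 (Ne.symm (mul_ne_zero (by
      intro h; have := hσ i₀; simp [h] at this) hi₀))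
    obtain ⟨t, ht, i, hi, hti⟩ := H (w := -w) (fun i hi => by simp [hw i hi])
      (by simpa using h0) (by simpa using hi₀) (fun _ => by simpa using h1)
    exact ⟨-t, by simpa using ht, i, by simpa using hi, by simpa using hti⟩
  have hcell : ∀ t, InCell θ σ S (v + t • w) ↔
      (∀ i ∈ S, θ i ≤ σ i * (v i + t * w i)) ∧ ∀ i ∉ S, |v i + t * w i| ≤ θ i := fun t => Iff.rfl
  have habs : ∀ i (x : ℝ), σ i * x ≤ |x| := fun i x =>
    (le_abs_self _).trans (by rw [abs_mul, hσ, one_mul])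
  let T : Set ℝ := {t | 0 ≤ t ∧ InCell θ σ S (v + t • w)}
  have hclosed : IsClosed T := by
    have : T = Set.Ici 0 ∩ ((⋂ i ∈ S, {t | θ i ≤ σ i * (v i + t * w i)}) ∩
        ⋂ i ∈ Sᶜ, {t | |v i + t * w i| ≤ θ i}) := by
      ext t
      simp [T, hcell]
    rw [this]
    refine isClosed_Ici.inter (.inter ?_ ?_)
    · exact isClosed_biInter fun i _ => isClosed_le (by fun_prop) (by fun_prop)
    · exact isClosed_biInter fun i _ => isClosed_le (by fun_prop) (by fun_prop)
  have hbdd : T ⊆ Set.Icc 0 ((θ i₀ + |v i₀|) / |w i₀|) := by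
    rintro t ⟨ht, hc⟩
    refine ⟨ht, ?_⟩
    have hwpos : 0 < |w i₀| := abs_pos.2 hi₀
    rw [le_div_iff₀ hwpos]
    by_cases hS : i₀ ∈ S
    · have h1 := hc.1 i₀ hS
      have h2 : -(σ i₀ * w i₀) = |w i₀| := by
        rw [← abs_of_neg (hsgn hS), abs_mul, hσ, one_mul]
      simp only [Pi.add_apply, Pi.smul_apply, smul_eq_mul] at h1
      have h3 := habs i₀ (v i₀)
      have h4 := hθ i₀
      rw [← h2]
      nlinarith
    · have h1 := hc.2 i₀ hS
      simp only [Pi.add_apply, Pi.smul_apply, smul_eq_mul] at h1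
      have h2 : |t * w i₀| ≤ |v i₀ + t * w i₀| + |v i₀| := by
        calc |t * w i₀| = |(v i₀ + t * w i₀) - v i₀| := by ring_nf
          _ ≤ _ := abs_sub _ _
      rw [abs_mul, abs_of_nonneg ht] at h2
      linarith
  have hcomp : IsCompact T := isCompact_Icc.of_isClosed_subset hclosed hbdd
  obtain ⟨t, ⟨ht, hc⟩, hmax⟩ := hcomp.exists_isGreatest ⟨0, le_rfl, by simpa using hv⟩
  refine ⟨t, hc, ?_⟩
  by_contra hno
  push Not at hno
  -- Without a tight moving coordinate, the constraints on moving coordinates are strict at `t` and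
  -- persist nearby, and the others do not change. This contradicts the maximality of `t`.
  have hev : ∀ᶠ t' in 𝓝 t, InCell θ σ S (v + t' • w) := by
    simp only [hcell]
    refine ((eventually_all_finset S).2 fun i hi => ?_).and
      ((eventually_all (ι := Fin N)).2 fun i => ?_)
    · by_cases hwi : w i = 0
      · have := hc.1 i hi
        simp only [Pi.add_apply, Pi.smul_apply, smul_eq_mul, hwi] at this
        simpa [hwi] using this
      · have h1 := hc.1 i hi
        have h2 : θ i < σ i * (v + t • w) i := by
          refine lt_of_le_of_ne h1 fun h => hno i hwi ?_
          rw [← abs_of_pos (hθ i), h, abs_mul, hσ, one_mul]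
        have h3 : ContinuousAt (fun t' => σ i * (v i + t' * w i)) t := by fun_prop
        exact (h3.eventually_const_lt h2).mono fun _ h => h.le
    · by_cases hi : i ∈ S
      · exact .of_forall fun _ h => absurd hi h
      by_cases hwi : w i = 0
      · have := hc.2 i hi
        simp only [Pi.add_apply, Pi.smul_apply, smul_eq_mul, hwi] at this
        simpa [hwi, hi] using this
      · have h1 := hc.2 i hi
        have h2 : |(v + t • w) i| < θ i := lt_of_le_of_ne h1 (hno i hwi)
        have h3 : ContinuousAt (fun t' => |v i + t' * w i|) t := by fun_prop
        exact (h3.eventually_lt_const h2).mono fun _ h _ => h.le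
  obtain ⟨t', ht', hlt⟩ :=
    ((hev.filter_mono nhdsWithin_le_nhds).and (self_mem_nhdsWithin (s := Set.Ioi t))).exists
  have hlt : t < t' := hlt
  exact absurd (hmax ⟨ht.trans hlt.le, ht'⟩) (not_le.2 hlt)

/-- At a point that is not a vertex, a nonzero direction in the range of `A` vanishes at all tight
coordinates, so moving along it keeps these and gains another. There are only `N` coordinates. -/
theorem InCell.exists_vertex (A : Matrix (Fin N) (Fin N) ℝ) {θ σ : Fin N → ℝ}
    (hθ : ∀ i, 0 < θ i) (hσ : ∀ i, |σ i| = 1) {S : Finset (Fin N)} {c₀ : Fin N → ℝ}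
    (h₀ : InCell θ σ S (A *ᵥ c₀)) :
    ∃ c, InCell θ σ S (A *ᵥ c) ∧
      ∀ d, (∀ i, |(A *ᵥ c) i| = θ i → (A *ᵥ d) i = 0) → A *ᵥ d = 0 := by
  by_contra hno
  push Not at hno
  let tight : (Fin N → ℝ) → Finset (Fin N) := fun v => Finset.univ.filter fun i => |v i| = θ i
  have hinc : ∀ n, ∃ c, InCell θ σ S (A *ᵥ c) ∧ n ≤ (tight (A *ᵥ c)).card := by
    intro n
    induction n with
    | zero => exact ⟨c₀, h₀, Nat.zero_le _⟩
    | succ n ih =>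
      obtain ⟨c, hc, hn⟩ := ih
      obtain ⟨d, hd, hne⟩ := hno c hc
      obtain ⟨t, ht, i, hi, hti⟩ := hc.exists_tight hθ hσ hd hne
      have heq : A *ᵥ (c + t • d) = A *ᵥ c + t • A *ᵥ d := by
        rw [mulVec_add, mulVec_smul]
      refine ⟨c + t • d, by rwa [heq], lt_of_le_of_lt hn (Finset.card_lt_card ?_)⟩
      rw [heq, Finset.ssubset_iff_of_subset]
      · refine ⟨i, by simpa [tight] using hti, fun h => hi (hd i ?_)⟩
        simpa [tight] using h
      · intro j hj
        have hj' : |(A *ᵥ c) j| = θ j := by simpa [tight] using hj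
        simp [tight, hd j hj', hj']
  obtain ⟨c, -, hn⟩ := hinc (N + 1)
  have := Finset.card_le_univ (tight (A *ᵥ c))
  rw [Fintype.card_fin] at this
  omega

end Vertex

end SparsePCA

/-! ### Sparse principal components of positive semidefinite matrices of given rank -/

namespace SparsePCA

open Matrix Finset Filter Topology

variable {D N : ℕ} {A : Matrix (Fin N) (Fin N) ℝ} {I : Fin D → Fin N}

theorem symm_apply (hA : A.PosSemidef) (i j : Fin N) : A i j = A j i := by
  simpa using (hA.isHermitian.apply i j).symm

theorem quad_nonneg {n : Type*} [Fintype n] {M : Matrix n n ℝ} (hM : M.PosSemidef) (x : n → ℝ) :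
    0 ≤ x ⬝ᵥ M *ᵥ x := by
  simpa using hM.dotProduct_mulVec_nonneg x

theorem mulVec_eq_zero {n : Type*} [Fintype n] {M : Matrix n n ℝ} (hM : M.PosSemidef) {x : n → ℝ}
    (h : x ⬝ᵥ M *ᵥ x ≤ 0) : M *ᵥ x = 0 :=
  (hM.dotProduct_mulVec_zero_iff x).1 (by simpa using le_antisymm h (quad_nonneg hM x))

theorem block_posSemidef (hA : A.PosSemidef) : (block A I).PosSemidef := hA.submatrix I

theorem mulVec_embed (A : Matrix (Fin N) (Fin N) ℝ) (I : Fin D → Fin N) (z : Fin D → ℝ)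
    (i : Fin N) :
    (A *ᵥ ((1 : Matrix (Fin N) (Fin N) ℝ).submatrix id I *ᵥ z)) i = row A I i ⬝ᵥ z := by
  have : A * (1 : Matrix (Fin N) (Fin N) ℝ).submatrix id I = A.submatrix id I := by
    ext i j
    simp [mul_apply, one_apply]
  rw [mulVec_mulVec, this]
  rfl

theorem embed_dotProduct (I : Fin D → Fin N) (z : Fin D → ℝ) (w : Fin N → ℝ) :
    ((1 : Matrix (Fin N) (Fin N) ℝ).submatrix id I *ᵥ z) ⬝ᵥ w = z ⬝ᵥ fun a => w (I a) := by
  rw [← vecMul_transpose, ← dotProduct_mulVec]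
  congr 1
  ext a
  simp [mulVec, dotProduct, one_apply]

theorem block_mulVec (A : Matrix (Fin N) (Fin N) ℝ) (I : Fin D → Fin N) (z : Fin D → ℝ)
    (a : Fin D) : (block A I *ᵥ z) a = row A I (I a) ⬝ᵥ z := rfl

/-- A vector in the range of `A` is a combination of the columns `I`. -/
theorem exists_mulVec_eq (hr : A.rank = D) (hdet : (block A I).det ≠ 0) (c : Fin N → ℝ) :
    ∃ z : Fin D → ℝ, (∀ i, (A *ᵥ c) i = row A I i ⬝ᵥ z) ∧
      z = (block A I)⁻¹ *ᵥ fun a => (A *ᵥ c) (I a) := by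
  have hu : IsUnit (block A I).det := isUnit_iff_ne_zero.2 hdet
  have h1 : (block A I).rank = D := by
    rw [rank_of_isUnit _ ((isUnit_iff_isUnit_det _).2 hu), Fintype.card_fin]
  have h2 : (block A I).rank ≤ (A.submatrix id I).rank :=
    rank_submatrix_le (A.submatrix id I) I id
  have h3 : LinearMap.range (A.submatrix id I).mulVecLin ≤ LinearMap.range A.mulVecLin := by
    rintro _ ⟨z, rfl⟩
    refine ⟨(1 : Matrix (Fin N) (Fin N) ℝ).submatrix id I *ᵥ z, ?_⟩
    ext i
    exact mulVec_embed A I z i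
  -- The columns `I` have rank at least that of the invertible block, namely `D`, so they span the
  -- whole range.
  have h4 := Submodule.eq_of_le_of_finrank_le h3 (by
    change A.rank ≤ (A.submatrix id I).rank
    omega)
  have h5 : A *ᵥ c ∈ LinearMap.range (A.submatrix id I).mulVecLin := by
    rw [h4]
    exact ⟨c, rfl⟩
  obtain ⟨z, hz⟩ := h5
  have h6 : ∀ i, (A *ᵥ c) i = row A I i ⬝ᵥ z := fun i => (congrFun hz i).symm
  refine ⟨z, h6, ?_⟩
  have h7 : (fun a => (A *ᵥ c) (I a)) = block A I *ᵥ z := funext fun a => h6 (I a)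
  rw [h7, mulVec_mulVec, nonsing_inv_mul _ hu, one_mulVec]

/-- The entries at `I` determine a vector of the range because the block is invertible. The symmetry
of its inverse turns the coefficients into `coord`. -/
theorem mulVec_eq_coord (hA : A.PosSemidef) (hr : A.rank = D) (hdet : (block A I).det ≠ 0)
    (c : Fin N → ℝ) (i : Fin N) :
    (A *ᵥ c) i = ∑ a, coord A I i a * (A *ᵥ c) (I a) := by
  obtain ⟨z, h1, rfl⟩ := exists_mulVec_eq hr hdet c
  rw [h1]
  have hs : ((block A I)⁻¹)ᵀ = (block A I)⁻¹ := by
    rw [transpose_nonsing_inv]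
    congr 1
    ext a b
    exact symm_apply hA _ _
  change _ = coord A I i ⬝ᵥ _
  rw [dotProduct_mulVec, ← mulVec_transpose, hs]
  rfl

/-- Independent rows, among rows that determine the range. -/
theorem exists_independent_rows (hA : A.PosSemidef) (hr : A.rank = D) (T : Finset (Fin N))
    (hT : ∀ d, (∀ i ∈ T, (A *ᵥ d) i = 0) → A *ᵥ d = 0) :
    ∃ I : Fin D → Fin N, StrictMono I ∧ (∀ a, I a ∈ T) ∧ (block A I).det ≠ 0 := by
  classical
  let M : Matrix T (Fin N) ℝ := A.submatrix Subtype.val id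
  have hker : LinearMap.ker M.mulVecLin = LinearMap.ker A.mulVecLin := by
    ext d
    simp only [LinearMap.mem_ker, mulVecLin_apply]
    refine ⟨fun h => hT d fun i hi => congrFun h ⟨i, hi⟩, fun h => ?_⟩
    ext i
    exact congrFun h i.1
  have hrank : M.rank = D := by
    have h1 := LinearMap.finrank_range_add_finrank_ker M.mulVecLin
    have h2 := LinearMap.finrank_range_add_finrank_ker A.mulVecLin
    rw [hker] at h1
    have h3 : M.rank = A.rank := by
      unfold Matrix.rank
      omega
    rw [h3, hr]
  obtain ⟨κ, a, ha, hspan, hli⟩ := exists_linearIndependent' ℝ M.row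
  have : Finite κ := Finite.of_injective a ha
  have : Fintype κ := Fintype.ofFinite κ
  have hcard : Fintype.card κ = D := by
    rw [← finrank_span_eq_card hli, hspan, ← rank_eq_finrank_span_row, hrank]
  let F : Finset (Fin N) := Finset.univ.image fun k => (a k).1
  have hF : F.card = D := by
    have : Function.Injective fun k => (a k).1 := Subtype.val_injective.comp ha
    rw [Finset.card_image_of_injective _ this, Finset.card_univ, hcard]
  let I := F.orderEmbOfFin hF
  have hmem : ∀ x, ∃ k, (a k).1 = I x := fun x => by
    obtain ⟨k, -, hk⟩ := Finset.mem_image.1 (Finset.orderEmbOfFin_mem F hF x)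
    exact ⟨k, hk⟩
  choose g hg using hmem
  have hgi : Function.Injective g := fun x y h => I.injective (by rw [← hg, ← hg, h])
  have hli' : LinearIndependent ℝ fun x => A (I x) := by
    have h1 := hli.comp g hgi
    have h2 : (M.row ∘ a) ∘ g = fun x => A (I x) := by
      funext x
      simp only [Function.comp_apply, ← hg]
      rfl
    rwa [h2] at h1
  refine ⟨I, I.strictMono, fun x => by rw [← hg]; exact (a (g x)).2, fun hdet => ?_⟩
  -- A kernel vector of the block, extended by zero to `y`, has `yᵀ A y = 0`. By positive
  -- semidefiniteness `A y = 0`, a linear relation between the chosen rows.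
  obtain ⟨z, hz, hBz⟩ := exists_mulVec_eq_zero_iff.2 hdet
  let y := (1 : Matrix (Fin N) (Fin N) ℝ).submatrix id I *ᵥ z
  have h1 : A *ᵥ y = 0 := by
    refine mulVec_eq_zero hA (le_of_eq ?_)
    rw [embed_dotProduct]
    have : (fun b => (A *ᵥ y) (I b)) = 0 := by
      funext b
      rw [mulVec_embed, ← block_mulVec, hBz]
    rw [this, dotProduct_zero]
  refine hz (funext fun b => Fintype.linearIndependent_iff.1 hli' z ?_ b)
  ext i
  have h2 := congrFun h1 i
  rw [mulVec_embed] at h2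
  simpa [dotProduct, row, mul_comm, symm_apply hA i] using h2

/-- One of the candidate supports carries at least as much of a vector in the range of `A` as any
other set with at most `K` elements. -/
theorem exists_candidate_support (hA : A.PosSemidef) (hr : A.rank = D) (y : Fin N → ℝ) (K : ℕ) :
    ∃ (I : Fin D → Fin N) (s : Fin D → ℤˣ) (J : Finset (Fin D)) (S : Finset (Fin N)),
      (block A I).det ≠ 0 ∧ (∀ i, i ∈ S ↔ Member A I s J i) ∧ S.card ≤ K ∧
      ∀ T : Finset (Fin N), T.card ≤ K →
        ∑ i ∈ T, (A *ᵥ y) i ^ 2 ≤ ∑ i ∈ S, (A *ᵥ y) i ^ 2 := by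
  classical
  set u := A *ᵥ y with hu
  -- Only finitely many comparisons occur, so a single `ε` serves all of them. The sign `τ` covers
  -- both halves of a comparison of absolute values.
  have ev1 : ∀ᶠ ε in 𝓝[>] (0 : ℝ), ∀ (I : Fin D → Fin N) (s : Fin D → ℤˣ) (i : Fin N) (τ : ℤˣ),
      StrictMono I → (∀ j, I j ≠ i) →
      (LexPos I i (fun j => ((τ : ℤ) : ℝ) * (((s j : ℤ) : ℝ) * coord A I i j)) →
        1 + ε ^ (i.val + 1) < ∑ j, ((τ : ℤ) : ℝ) * (((s j : ℤ) : ℝ) * coord A I i j) *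
          (1 + ε ^ ((I j).val + 1))) ∧
      (¬ LexPos I i (fun j => ((τ : ℤ) : ℝ) * (((s j : ℤ) : ℝ) * coord A I i j)) →
        ∑ j, ((τ : ℤ) : ℝ) * (((s j : ℤ) : ℝ) * coord A I i j) *
          (1 + ε ^ ((I j).val + 1)) < 1 + ε ^ (i.val + 1)) := by
    refine eventually_all.2 fun I => eventually_all.2 fun s => eventually_all.2 fun i =>
      eventually_all.2 fun τ => ?_
    by_cases h : StrictMono I ∧ ∀ j, I j ≠ i
    · exact (eventually_lexPos I h.1 i h.2 _).mono fun ε hε _ _ => hε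
    · exact .of_forall fun ε h1 h2 => absurd ⟨h1, h2⟩ h
  -- A small perturbation does not reverse a strict inequality, so the largest entries relative to
  -- `θ` are also largest entries of `u`.
  have ev2 : ∀ᶠ ε in 𝓝[>] (0 : ℝ), ∀ i j : Fin N, |u i| < |u j| →
      |u i| / (1 + ε ^ (i.val + 1)) < |u j| / (1 + ε ^ (j.val + 1)) := by
    refine eventually_all.2 fun i => eventually_all.2 fun j => ?_
    by_cases h : |u i| < |u j|
    · have hc : ∀ k : Fin N, Tendsto (fun ε : ℝ => |u k| / (1 + ε ^ (k.val + 1))) (𝓝[>] 0)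
          (𝓝 |u k|) := by
        intro k
        have : ContinuousAt (fun ε : ℝ => |u k| / (1 + ε ^ (k.val + 1))) 0 :=
          ContinuousAt.div (by fun_prop) (by fun_prop) (by simp)
        have h2 := this.tendsto
        simp only [ne_eq, Nat.add_eq_zero_iff, one_ne_zero, and_false, not_false_eq_true, zero_pow,
          add_zero, div_one] at h2
        exact h2.mono_left nhdsWithin_le_nhds
      exact ((hc i).eventually_lt (hc j) h).mono fun ε hε _ => hε
    · exact .of_forall fun ε h1 => absurd h1 h
  obtain ⟨ε, ⟨hlex, hord⟩, hε⟩ := ((ev1.and ev2).and self_mem_nhdsWithin).exists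
  have hε : 0 < ε := hε
  set θ : Fin N → ℝ := fun i => 1 + ε ^ (i.val + 1) with hθdef
  have hθ : ∀ i, 0 < θ i := fun i => by simp only [hθdef]; positivity
  obtain ⟨S, ρ, hρ, hcard, hin, hout, hfull⟩ :=
    exists_top (fun i => |u i| / θ i) (fun i => div_nonneg (abs_nonneg _) (hθ i).le) K
  let sgn : ℝ → ℤˣ := fun x => if 0 ≤ x then 1 else -1
  have hsgn : ∀ x, ((sgn x : ℤ) : ℝ) * x = |x| := by
    intro x
    by_cases hx : 0 ≤ x
    · simp [sgn, hx, abs_of_nonneg]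
    · simp [sgn, hx, abs_of_neg (not_le.1 hx)]
  have hsgn' : ∀ x, |((sgn x : ℤ) : ℝ)| = 1 := by
    intro x
    rcases Int.units_eq_one_or (sgn x) with h | h <;> simp [h]
  have hcell : InCell θ (fun i => ((sgn (u i) : ℤ) : ℝ)) S (A *ᵥ (ρ⁻¹ • y)) := by
    rw [mulVec_smul, ← hu]
    constructor
    · intro i hi
      have h1 := hin i hi
      rw [le_div_iff₀ (hθ i)] at h1
      have : ((sgn (u i) : ℤ) : ℝ) * (ρ⁻¹ • u) i = ρ⁻¹ * |u i| := by
        rw [← hsgn]; simp; ring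
      rw [this, ← div_eq_inv_mul, le_div_iff₀ hρ]
      linarith
    · intro i hi
      have h1 := hout i hi
      rw [div_le_iff₀ (hθ i)] at h1
      rw [Pi.smul_apply, smul_eq_mul, abs_mul, abs_of_pos (inv_pos.2 hρ), ← div_eq_inv_mul,
        div_le_iff₀ hρ]
      linarith
  obtain ⟨c, hc, hvert⟩ := InCell.exists_vertex A hθ (fun i => hsgn' (u i)) hcell
  set v := A *ᵥ c with hv
  obtain ⟨I, hI, hIt, hdet⟩ := exists_independent_rows hA hr
    (Finset.univ.filter fun i => |v i| = θ i) (fun d hd => hvert d fun i hi => hd i (by simpa using hi))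
  have hIt' : ∀ a, |v (I a)| = θ (I a) := fun a => by simpa using hIt a
  have hvI : ∀ a, v (I a) = ((sgn (v (I a)) : ℤ) : ℝ) * θ (I a) := by
    intro a
    rw [← hIt', ← hsgn, ← mul_assoc, ← Int.cast_mul, ← Units.val_mul, Int.units_mul_self]
    simp
  -- The vertex has entries `± θ` on `I`. There membership in `S` is not visible from the vertex,
  -- hence the set `J`.
  refine ⟨I, fun a => sgn (v (I a)), Finset.univ.filter fun a => I a ∈ S, S, hdet, fun i => ?_,
    hcard, fun T hT => ?_⟩
  · by_cases hi : ∃ a, I a = i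
    · obtain ⟨a, rfl⟩ := hi
      constructor
      · exact fun h => .inl ⟨a, by simpa using h, rfl⟩
      · rintro (⟨b, hb, hba⟩ | ⟨h, -⟩)
        · rw [← hba]; simpa using hb
        · exact absurd rfl (h a)
    push Not at hi
    have hvi : v i = ∑ a, ((sgn (v (I a)) : ℤ) : ℝ) * coord A I i a * θ (I a) := by
      rw [hv, mulVec_eq_coord hA hr hdet, ← hv]
      refine Finset.sum_congr rfl fun a _ => ?_
      linear_combination (coord A I i a) * hvI a
    obtain ⟨p1, p2⟩ := hlex I (fun a => sgn (v (I a))) i 1 hI hi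
    obtain ⟨n1, n2⟩ := hlex I (fun a => sgn (v (I a))) i (-1) hI hi
    simp only [Units.val_one, Int.cast_one, one_mul] at p1 p2
    simp only [Units.val_neg, Units.val_one, Int.cast_neg, Int.cast_one, neg_mul, one_mul,
      Finset.sum_neg_distrib] at n1 n2
    change _ → θ i < ∑ a, ((sgn (v (I a)) : ℤ) : ℝ) * coord A I i a * θ (I a) at p1
    change _ → ∑ a, ((sgn (v (I a)) : ℤ) : ℝ) * coord A I i a * θ (I a) < θ i at p2
    change _ → θ i < -∑ a, ((sgn (v (I a)) : ℤ) : ℝ) * coord A I i a * θ (I a) at n1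
    change _ → -∑ a, ((sgn (v (I a)) : ℤ) : ℝ) * coord A I i a * θ (I a) < θ i at n2
    rw [← hvi] at p1 p2 n1 n2
    -- Off `I` the inequalities `p1`, `p2`, `n1`, `n2` are strict, so comparing `|v i|` with `θ i`
    -- decides membership in `S`.
    constructor
    · intro hS
      refine .inr ⟨hi, ?_⟩
      by_contra hno
      push Not at hno
      have h1 := abs_lt.2 ⟨neg_lt.1 (n2 hno.2), p2 hno.1⟩
      have h2 := hc.1 i hS
      have h3 : ((sgn (u i) : ℤ) : ℝ) * v i ≤ |v i| :=
        (le_abs_self _).trans (by rw [abs_mul, hsgn', one_mul])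
      exact absurd (h2.trans h3) (not_le.2 h1)
    · intro hm
      by_contra hS
      have h1 := abs_le.1 (hc.2 i hS)
      rcases hm with ⟨b, -, hb⟩ | ⟨-, h | h⟩
      · exact hi b hb
      · linarith [p1 h]
      · linarith [n1 h]
  · refine sum_le_sum_of_top S T _ (fun i => sq_nonneg _) (fun i hi j hj => ?_) ?_
    · rw [sq_le_sq]
      by_contra hlt
      exact absurd (hord i j (not_le.1 hlt)) (not_lt.2 ((hout j hj).trans (hin i hi)))
    · rcases hfull with h | h
      · exact .inl (hT.trans h.ge)
      · refine .inr fun i hi => ?_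
        have := (div_eq_zero_iff.1 (h i hi)).resolve_right (hθ i).ne'
        rw [abs_eq_zero.1 this, zero_pow two_ne_zero]

/-! ### The generalized eigenvalue problem on a support -/

section Root

variable {S : Finset (Fin N)}

theorem spread_dotProduct (A : Matrix (Fin N) (Fin N) ℝ) (I : Fin D → Fin N)
    (S : Finset (Fin N)) (z : Fin D → ℝ) (w : Fin N → ℝ) :
    spread A I S z ⬝ᵥ w = ∑ i ∈ S, (row A I i ⬝ᵥ z) * w i := by
  classical
  simp [dotProduct, spread, ite_mul, Finset.sum_ite_mem]

theorem gram_mulVec (E : Matrix (Fin N) (Fin N) ℝ) (I : Fin D → Fin N) (S : Finset (Fin N))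
    (z : Fin D → ℝ) (a : Fin D) :
    (gram E I S *ᵥ z) a = ∑ i ∈ S, row E I i a * (row E I i ⬝ᵥ z) := by
  simp only [gram, mulVec, dotProduct, of_apply, Finset.sum_mul, Finset.mul_sum]
  rw [Finset.sum_comm]
  simp only [mul_assoc]

theorem mulVec_spread (hA : A.PosSemidef) (z : Fin D → ℝ) (a : Fin D) :
    (A *ᵥ spread A I S z) (I a) = (gram A I S *ᵥ z) a := by
  change A (I a) ⬝ᵥ spread A I S z = _
  rw [dotProduct_comm, spread_dotProduct, gram_mulVec]
  refine Finset.sum_congr rfl fun i _ => ?_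
  rw [mul_comm, symm_apply hA]
  rfl

theorem spread_self (A : Matrix (Fin N) (Fin N) ℝ) (I : Fin D → Fin N)
    (S : Finset (Fin N)) (z : Fin D → ℝ) :
    spread A I S z ⬝ᵥ spread A I S z = z ⬝ᵥ gram A I S *ᵥ z := by
  classical
  rw [spread_dotProduct]
  have h1 : ∀ i ∈ S, (row A I i ⬝ᵥ z) * spread A I S z i =
      ∑ a, z a * (row A I i a * (row A I i ⬝ᵥ z)) := by
    intro i hi
    rw [spread, if_pos hi]
    nth_rewrite 1 [dotProduct]
    rw [Finset.sum_mul]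
    exact Finset.sum_congr rfl fun a _ => by ring
  rw [Finset.sum_congr rfl h1, Finset.sum_comm, dotProduct]
  refine Finset.sum_congr rfl fun a _ => ?_
  rw [gram_mulVec, Finset.mul_sum]

/-- A positive generalized eigenvalue is the value of the quadratic form at a vector with support
in `S`. -/
theorem spread_value (hA : A.PosSemidef) (hr : A.rank = D) (hdet : (block A I).det ≠ 0)
    {t : ℝ} (ht : 0 < t) {z : Fin D → ℝ} (hz : z ≠ 0)
    (h : (t • block A I - gram A I S) *ᵥ z = 0) :
    0 < z ⬝ᵥ gram A I S *ᵥ z ∧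
      spread A I S z ⬝ᵥ A *ᵥ spread A I S z = t * (z ⬝ᵥ gram A I S *ᵥ z) := by
  classical
  have hG : gram A I S *ᵥ z = t • block A I *ᵥ z := by
    rw [sub_mulVec, sub_eq_zero, smul_mulVec] at h
    exact h.symm
  have hpd := (block_posSemidef (I := I) hA).posDef_iff_det_ne_zero.2 hdet
  refine ⟨?_, ?_⟩
  · rw [hG, dotProduct_smul, smul_eq_mul]
    have := hpd.dotProduct_mulVec_pos hz
    rw [star_trivial] at this
    positivity
  · obtain ⟨w, h1, h2⟩ := exists_mulVec_eq hr hdet (spread A I S z)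
    -- The block maps both `w` and `t • z` to `G z`. Hence `A *ᵥ x` equals `t • x` on `S`, where `x`
    -- is the vector `spread A I S z`.
    have h3 : w = t • z := by
      have : (fun a => (A *ᵥ spread A I S z) (I a)) = block A I *ᵥ (t • z) := by
        rw [mulVec_smul, ← hG]
        exact funext fun a => mulVec_spread hA z a
      rw [h2, this, mulVec_mulVec, nonsing_inv_mul _ (isUnit_iff_ne_zero.2 hdet), one_mulVec]
    rw [← spread_self, spread_dotProduct, spread_dotProduct, Finset.mul_sum]
    refine Finset.sum_congr rfl fun i hi => ?_
    rw [h1, h3, dotProduct_smul, smul_eq_mul, spread, if_pos hi]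
    ring

end Root

/-! ### Optimal sparse unit vectors -/

section Sphere

theorem mem_sparseSphere {K : ℕ} {x : EuclideanSpace ℝ (Fin N)} :
    x ∈ sparseSphere N K ↔ x.ofLp ⬝ᵥ x.ofLp = 1 ∧
      (Finset.univ.filter fun i => x i ≠ 0).card ≤ K := by
  have h : ‖x‖ = 1 ↔ x.ofLp ⬝ᵥ x.ofLp = 1 := by
    rw [← sq_eq_sq₀ (norm_nonneg x) zero_le_one, EuclideanSpace.real_norm_sq_eq, one_pow]
    simp only [dotProduct, sq]
  rw [← h]
  rfl

/-- The vector obtained by normalizing one with small support. -/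
theorem normalize_mem {K : ℕ} {x : Fin N → ℝ} {n : ℝ} (hn : 0 < n) (hx : x ⬝ᵥ x = n ^ 2)
    {S : Finset (Fin N)} (hS : S.card ≤ K) (h : ∀ i ∉ S, x i = 0) :
    WithLp.toLp 2 (fun i => x i / n) ∈ sparseSphere N K := by
  rw [mem_sparseSphere]
  constructor
  · have : (fun i => x i / n) ⬝ᵥ (fun i => x i / n) = (x ⬝ᵥ x) / n ^ 2 := by
      simp only [dotProduct, Finset.sum_div]
      exact Finset.sum_congr rfl fun i _ => by ring
    change (fun i => x i / n) ⬝ᵥ (fun i => x i / n) = 1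
    rw [this, hx, div_self (by positivity)]
  · refine (Finset.card_le_card fun i hi => ?_).trans hS
    by_contra hiS
    simp [h i hiS] at hi

theorem quad_normalize (A : Matrix (Fin N) (Fin N) ℝ) (x : Fin N → ℝ) (n : ℝ) :
    (fun i => x i / n) ⬝ᵥ A *ᵥ (fun i => x i / n) = (x ⬝ᵥ A *ᵥ x) / n ^ 2 := by
  have : (fun i => x i / n) = n⁻¹ • x := by
    funext i
    simp [div_eq_inv_mul]
  rw [this, mulVec_smul, dotProduct_smul, smul_dotProduct, smul_eq_mul, smul_eq_mul]
  ring

/-- The sparse sphere is compact: it is the intersection of the sphere with a finite union of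
coordinate subspaces. -/
theorem exists_isMaxOn (A : Matrix (Fin N) (Fin N) ℝ) {K : ℕ} (hK : 1 ≤ K) (hN : 1 ≤ N) :
    ∃ y ∈ sparseSphere N K,
      ∀ x ∈ sparseSphere N K, x.ofLp ⬝ᵥ A *ᵥ x.ofLp ≤ y.ofLp ⬝ᵥ A *ᵥ y.ofLp := by
  classical
  have hcl : IsClosed (sparseSphere N K) := by
    have : sparseSphere N K = Metric.sphere 0 1 ∩
        ⋃ S ∈ {S : Finset (Fin N) | S.card ≤ K}, ⋂ i ∈ Sᶜ, {x | x i = 0} := by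
      ext x
      simp only [sparseSphere, Set.mem_ofPred_eq, Set.mem_inter_iff, mem_sphere_iff_norm, sub_zero,
        Set.mem_iUnion, Set.mem_iInter, exists_prop, Finset.mem_compl]
      refine and_congr_right fun _ => ⟨fun h => ⟨_, h, fun i hi => by simpa using hi⟩, ?_⟩
      rintro ⟨S, hS, h⟩
      refine (Finset.card_le_card fun i hi => ?_).trans hS
      by_contra hiS
      simp [h i hiS] at hi
    rw [this]
    refine Metric.isClosed_sphere.inter ((Set.toFinite _).isClosed_biUnion fun S _ => ?_)
    exact isClosed_biInter fun i _ => isClosed_eq (by fun_prop) continuous_const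
  have hcomp : IsCompact (sparseSphere N K) :=
    (isCompact_sphere (0 : EuclideanSpace ℝ (Fin N)) 1).of_isClosed_subset hcl
      fun x hx => by simpa using hx.1
  have hne : (sparseSphere N K).Nonempty := by
    refine ⟨EuclideanSpace.single ⟨0, hN⟩ 1, by simp, ?_⟩
    refine le_trans ?_ hK
    rw [Finset.card_le_one]
    intro i hi j hj
    simp at hi hj
    rw [hi, hj]
  obtain ⟨y, hy, hmax⟩ := hcomp.exists_isMaxOn hne
    (f := fun y : EuclideanSpace ℝ (Fin N) => y.ofLp ⬝ᵥ A *ᵥ y.ofLp) (by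
      refine Continuous.continuousOn ?_
      simp only [dotProduct, mulVec]
      fun_prop)
  exact ⟨y, hy, fun x hx => hmax hx⟩

/-- The largest value of the quadratic form on the sparse sphere is the largest generalized
eigenvalue of some candidate. -/
theorem exists_candidate (hA : A.PosSemidef) (hr : A.rank = D) {K : ℕ}
    {y : EuclideanSpace ℝ (Fin N)} (hy : y ∈ sparseSphere N K)
    (hmax : ∀ x ∈ sparseSphere N K, x.ofLp ⬝ᵥ A *ᵥ x.ofLp ≤ y.ofLp ⬝ᵥ A *ᵥ y.ofLp)
    (hpos : 0 < y.ofLp ⬝ᵥ A *ᵥ y.ofLp) :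
    ∃ (I : Fin D → Fin N) (s : Fin D → ℤˣ) (J : Finset (Fin D)) (S : Finset (Fin N)),
      (block A I).det ≠ 0 ∧ (∀ i, i ∈ S ↔ Member A I s J i) ∧ S.card ≤ K ∧
      topRoot A I S = y.ofLp ⬝ᵥ A *ᵥ y.ofLp ∧
      (topRoot A I S • block A I - gram A I S).det = 0 := by
  classical
  obtain ⟨I, s, J, S, hdet, hS, hcard, hbest⟩ := exists_candidate_support hA hr y.ofLp K
  set q := y.ofLp ⬝ᵥ A *ᵥ y.ofLp with hq
  set u := A *ᵥ y.ofLp with hu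
  rw [mem_sparseSphere] at hy
  set T := Finset.univ.filter fun i => y i ≠ 0 with hT
  have hqT : q = ∑ i ∈ T, y i * u i := by
    rw [hq, dotProduct, hT, Finset.sum_filter]
    refine Finset.sum_congr rfl fun i _ => ?_
    by_cases h : y i = 0 <;> simp [h]
  have hy1 : ∑ i ∈ T, y i ^ 2 = 1 := by
    rw [← hy.1, dotProduct, hT, Finset.sum_filter]
    refine Finset.sum_congr rfl fun i _ => ?_
    by_cases h : y i = 0 <;> simp [h, sq]
  have hCS : q ^ 2 ≤ ∑ i ∈ T, u i ^ 2 := by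
    have := Finset.sum_mul_sq_le_sq_mul_sq T (fun i => y i) u
    rwa [hy1, one_mul, ← hqT] at this
  set n := ∑ i ∈ S, u i ^ 2 with hn
  have hqn : q ^ 2 ≤ n := hCS.trans (hbest T hy.2)
  have hnpos : 0 < n := lt_of_lt_of_le (by positivity) hqn
  set x : Fin N → ℝ := fun i => if i ∈ S then u i else 0 with hx
  have hxw : ∀ w : Fin N → ℝ, x ⬝ᵥ w = ∑ i ∈ S, u i * w i := fun w => by
    simp [hx, dotProduct, ite_mul, Finset.sum_ite_mem]
  have hxu : x ⬝ᵥ u = n := by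
    rw [hxw, hn]; simp only [sq]
  have hxx : x ⬝ᵥ x = n := by
    rw [hxw, hn]
    exact Finset.sum_congr rfl fun i hi => by simp [hx, hi, sq]
  have hsq : √n ^ 2 = n := Real.sq_sqrt hnpos.le
  have hxval : x ⬝ᵥ A *ᵥ x ≤ q * n := by
    have h1 := hmax _ (normalize_mem (Real.sqrt_pos.2 hnpos) (by rw [hxx, hsq]) hcard
      (fun i hi => by simp [hx, hi]))
    change (fun i => x i / √n) ⬝ᵥ A *ᵥ (fun i => x i / √n) ≤ q at h1
    rwa [quad_normalize, hsq, div_le_iff₀ hnpos] at h1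
  have hsym : y.ofLp ⬝ᵥ A *ᵥ x = n := by
    have hAt : Aᵀ = A := by
      ext i j
      exact symm_apply hA _ _
    rw [dotProduct_mulVec, ← mulVec_transpose, hAt, ← hu, dotProduct_comm, hxu]
  -- The form at `x - q y` is at most `q n - 2 q n + q ^ 3 = q (q ^ 2 - n) ≤ 0`, so `A` annihilates
  -- this vector.
  have hAx : A *ᵥ x = q • u := by
    have h1 : A *ᵥ (x - q • y.ofLp) = 0 := by
      refine mulVec_eq_zero hA ?_
      have : (x - q • y.ofLp) ⬝ᵥ A *ᵥ (x - q • y.ofLp) =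
          x ⬝ᵥ A *ᵥ x - 2 * q * n + q ^ 2 * q := by
        rw [mulVec_sub, mulVec_smul, ← hu, sub_dotProduct, dotProduct_sub, dotProduct_sub,
          dotProduct_smul, dotProduct_smul, smul_dotProduct, smul_dotProduct, hxu, hsym, ← hq]
        simp only [smul_eq_mul]
        ring
      rw [this]
      nlinarith
    rwa [mulVec_sub, mulVec_smul, sub_eq_zero] at h1
  obtain ⟨z, hz1, hz2⟩ := exists_mulVec_eq hr hdet x
  have hu0 : u ≠ 0 := by
    rintro h
    rw [hq, h, dotProduct_zero] at hpos
    exact lt_irrefl _ hpos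
  have hz0 : z ≠ 0 := by
    rintro rfl
    have : q • u = 0 := by
      rw [← hAx]
      ext i
      rw [hz1, dotProduct_zero]
      rfl
    exact (smul_eq_zero.1 this).elim hpos.ne' hu0
  have hBz : block A I *ᵥ z = fun a => (A *ᵥ x) (I a) := by
    rw [hz2, mulVec_mulVec, mul_nonsing_inv _ (isUnit_iff_ne_zero.2 hdet), one_mulVec]
  have hroot : (q • block A I - gram A I S) *ᵥ z = 0 := by
    rw [sub_mulVec, sub_eq_zero, smul_mulVec, hBz]
    ext a
    rw [gram_mulVec]
    have h1 : ∀ i ∈ S, row A I i a * (row A I i ⬝ᵥ z) = q * (u i * A (I a) i) := by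
      intro i _
      rw [← hz1, hAx, symm_apply hA (I a) i]
      simp only [row, Pi.smul_apply, smul_eq_mul]
      ring
    rw [Finset.sum_congr rfl h1, ← Finset.mul_sum, ← hxw, dotProduct_comm]
    rfl
  have hdetq : (q • block A I - gram A I S).det = 0 :=
    exists_mulVec_eq_zero_iff.1 ⟨z, hz0, hroot⟩
  -- A positive root is the value of a normalized vector supported in `S`, so optimality bounds it
  -- by `q`.
  have hgreatest : IsGreatest {t : ℝ | (t • block A I - gram A I S).det = 0} q := by
    refine ⟨hdetq, fun t ht => ?_⟩
    rcases le_or_gt t 0 with h0 | h0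
    · exact h0.trans hpos.le
    obtain ⟨w, hw, hw'⟩ := exists_mulVec_eq_zero_iff.2 (show _ = _ from ht)
    obtain ⟨g1, g2⟩ := spread_value hA hr hdet h0 hw hw'
    set g := w ⬝ᵥ gram A I S *ᵥ w with hg
    have hsq : √g ^ 2 = g := Real.sq_sqrt g1.le
    have h1 := hmax _ (normalize_mem (x := spread A I S w) (Real.sqrt_pos.2 g1)
      (by rw [spread_self, hsq]) hcard (fun i hi => by simp [spread, hi]))
    change (fun i => spread A I S w i / √g) ⬝ᵥ A *ᵥ (fun i => spread A I S w i / √g) ≤ q at h1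
    rwa [quad_normalize, hsq, g2, mul_div_assoc, div_self g1.ne', mul_one] at h1
  have htop : topRoot A I S = q := hgreatest.csSup_eq
  exact ⟨I, s, J, S, hdet, hS, hcard, htop, by rw [htop, hdetq]⟩

end Sphere

end SparsePCA

/-! ### Kernel vectors of singular matrices -/

namespace SparsePCA

open Matrix RealRAM

/-- The coefficient of `X ^ k` in the column `b` of the adjugate of `X + M`. -/
noncomputable def kernelVec {n : ℕ} (k : ℕ) (b : Fin n) (M : Matrix (Fin n) (Fin n) ℝ) :
    Fin n → ℝ :=
  fun a => ((-M).charmatrix.adjugate a b).coeff k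

/-- Write `adj (X + M) = ∑ Z k X ^ k`. Comparing coefficients in `(X + M) adj (X + M) = det (X + M)`
gives `Z (k - 1) + M Z k = c k`, with scalar right-hand side. For the first nonzero `Z k` this reads
`M Z k = c k`, and `det M = 0` forces `c k = 0`. Any nonzero column of `Z k` is then a kernel
vector. -/
theorem exists_kernelVec {n : ℕ} (M : Matrix (Fin n) (Fin n) ℝ) (h : M.det = 0) :
    ∃ k ≤ n, ∃ b, kernelVec k b M ≠ 0 ∧ M *ᵥ kernelVec k b M = 0 := by
  classical
  have hn : n ≠ 0 := by
    rintro rfl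
    simp at h
  let Z : ℕ → Matrix (Fin n) (Fin n) ℝ := fun k => .of fun a b => kernelVec k b M a
  have hmul : ∀ a c, Polynomial.X * (-M).charmatrix.adjugate a c +
      ∑ b, Polynomial.C (M a b) * (-M).charmatrix.adjugate b c =
        if a = c then (-M).charpoly else 0 := by
    intro a c
    have h1 := congrFun (congrFun (mul_adjugate (-M).charmatrix) a) c
    rw [mul_apply] at h1
    simp only [charmatrix_apply, Matrix.neg_apply, map_neg, sub_neg_eq_add, add_mul,
      Finset.sum_add_distrib, diagonal_apply, ite_mul, zero_mul, Finset.sum_ite_eq,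
      Finset.mem_univ, if_true] at h1
    rw [h1]
    simp [one_apply, Matrix.charpoly]
  have h0 : M * Z 0 = (-M).charpoly.coeff 0 • 1 := by
    ext a c
    have h1 := congrArg (fun p => p.coeff 0) (hmul a c)
    simp only [Polynomial.coeff_add, Polynomial.coeff_X_mul_zero, zero_add,
      Polynomial.finsetSum_coeff, Polynomial.coeff_C_mul] at h1
    rw [mul_apply, Matrix.smul_apply, one_apply]
    refine h1.trans ?_
    split_ifs <;> simp
  have hsucc : ∀ k, Z k + M * Z (k + 1) = (-M).charpoly.coeff (k + 1) • 1 := by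
    intro k
    ext a c
    have h1 := congrArg (fun p => p.coeff (k + 1)) (hmul a c)
    simp only [Polynomial.coeff_add, Polynomial.coeff_X_mul,
      Polynomial.finsetSum_coeff, Polynomial.coeff_C_mul] at h1
    rw [Matrix.add_apply, mul_apply, Matrix.smul_apply, one_apply]
    refine h1.trans ?_
    split_ifs <;> simp
  have hex : ∃ k, k ≤ n ∧ Z k ≠ 0 := by
    by_contra hno
    push Not at hno
    -- If all `Z k` with `k ≤ n` vanished, the relation in degree `n` would contradict that the
    -- characteristic polynomial is monic.
    obtain ⟨l, rfl⟩ := Nat.exists_eq_succ_of_ne_zero hn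
    have h1 := hsucc l
    rw [hno l (by omega), hno (l + 1) le_rfl, mul_zero, add_zero] at h1
    have h2 : (-M).charpoly.coeff (l + 1) = 1 := by
      have := (-M).charpoly_monic.coeff_natDegree
      rwa [charpoly_natDegree_eq_dim, Fintype.card_fin] at this
    rw [h2, one_smul] at h1
    exact one_ne_zero h1.symm
  obtain ⟨hk, hZ⟩ := Nat.find_spec hex
  set k := Nat.find hex
  have hmin : ∀ l < k, Z l = 0 := fun l hl => by
    by_contra hne
    exact Nat.find_min hex hl ⟨hl.le.trans hk, hne⟩
  have hMZ : M * Z k = (-M).charpoly.coeff k • 1 := by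
    rcases Nat.eq_zero_or_eq_succ_pred k with h1 | h1
    · rw [h1, h0]
    · have h2 := hsucc k.pred
      rw [hmin _ (by omega), zero_add, ← Nat.succ_eq_add_one, ← h1] at h2
      exact h2
  have hc : (-M).charpoly.coeff k = 0 := by
    have h1 := congrArg det hMZ
    rw [det_mul, h, zero_mul, det_smul, det_one, mul_one, Fintype.card_fin] at h1
    exact pow_eq_zero_iff hn |>.1 h1.symm
  rw [hc, zero_smul] at hMZ
  obtain ⟨a, ha⟩ := Function.ne_iff.1 hZ
  obtain ⟨b, hb⟩ := Function.ne_iff.1 ha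
  refine ⟨k, hk, b, fun h1 => hb (congrFun h1 a), ?_⟩
  ext c
  exact congrFun (congrFun hMZ c) b

/-- The adjugate of `t + M` has entries that are polynomials in `t` with expressions as
coefficients. Polynomials with the same values coincide, so the listed coefficients are those in
`kernelVec`; beyond the list both are zero. -/
theorem isExpr_kernelVec {n : ℕ} (k : ℕ) (b a : Fin n) {M : Memory → Matrix (Fin n) (Fin n) ℝ}
    (h : ∀ i j, IsExpr fun m => M m i j) : IsExpr fun m => kernelVec k b (M m) a := by
  have h1 : IsPoly fun m t => (t • (1 : Matrix (Fin n) (Fin n) ℝ) + M m).adjugate a b := by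
    refine IsPoly.adjugate (fun i j => ?_) a b
    simp only [Matrix.add_apply, Matrix.smul_apply, smul_eq_mul]
    refine (IsPoly.id.mul (.of_isExpr ?_)).add (.of_isExpr (h i j))
    by_cases hij : i = j
    · simpa [one_apply, hij] using IsExpr.one
    · simpa [one_apply, hij] using IsExpr.zero
  obtain ⟨cs, hcs⟩ := h1
  refine ⟨cs.getD k (.lit 0), fun m => ?_⟩
  obtain ⟨p, hp1, hp2⟩ := exists_polynomial (cs.map (RExpr.eval m))
  have hp : p = (-M m).charmatrix.adjugate a b := by
    refine Polynomial.funext fun t => ?_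
    rw [hp1, hcs]
    have h2 := congrFun (congrFun (RingHom.map_adjugate (Polynomial.evalRingHom t)
      (-M m).charmatrix) a) b
    have h3 : (Polynomial.evalRingHom t).mapMatrix (-M m).charmatrix =
        t • (1 : Matrix (Fin n) (Fin n) ℝ) + M m := by
      ext i j
      by_cases hij : i = j <;> simp [hij]
    rw [h3] at h2
    exact h2.symm
  have h0 : (List.map (RExpr.eval m) cs).getD k 0 = RExpr.eval m (cs.getD k (.lit 0)) := by
    have : (0 : ℝ) = RExpr.eval m (.lit 0) := by simp [RExpr.eval]
    rw [this, List.getD_map]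
  exact h0.symm.trans ((hp2 k).symm.trans (congrArg (fun q => q.coeff k) hp))

/-! ### The parts of the program -/

variable {D : ℕ}

/-- The part of the memory that holds the instance and the counters of the outer loops. -/
abbrev View : Type := (ℕ → ℕ) × (ℕ → ℕ) × (ℕ → ℕ → ℝ)

/-- The instance and the counters. -/
def view (m : Memory) : View := (m.nat 0, m.nat 1, m.real 0)

/-- The matrix of the instance. -/
def View.mat (w : View) : Matrix ℕ ℕ ℝ := .of w.2.2

/-- The indices given by the counters. -/
def View.idx (D : ℕ) (w : View) : Fin D → ℕ := fun a => w.2.1 a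

open Classical in
/-- The candidate support. -/
noncomputable def View.supp (w : View) (s : Fin D → ℤˣ) (J : Finset (Fin D)) : Finset ℕ :=
  (Finset.range (w.1 0)).filter (Member w.mat (w.idx D) s J)

theorem view_storeReal (m : Memory) {a : ℕ} (ha : a ≠ 0) (i j : ℕ) (v : ℝ) :
    view (m.storeReal a i j v) = view m := by
  simp [view, Memory.storeReal, ha.symm]

theorem view_storeNat (m : Memory) {a : ℕ} (ha : 2 ≤ a) (i v : ℕ) :
    view (m.storeNat a i v) = view m := by
  have h0 : 0 ≠ a := by omega
  have h1 : 1 ≠ a := by omega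
  simp [view, Memory.storeNat, h0, h1]

theorem view_eq {m m' : Memory} (h : view m' = view m) :
    m'.nat 0 = m.nat 0 ∧ m'.nat 1 = m.nat 1 ∧ m'.real 0 = m.real 0 := by
  simpa [view] using h

/-! ### Entries and membership as constant-time computations -/

section Expressions

theorem isExpr_block (a b : Fin D) :
    IsExpr fun m => block (view m).mat ((view m).idx D) a b :=
  IsExpr.cell 0 (.read 1 (.lit a)) (.read 1 (.lit b))

theorem isExpr_row (a : Fin D) :
    IsExpr fun m => row (view m).mat ((view m).idx D) (m.nat 2 0) a :=
  IsExpr.cell 0 (.read 2 (.lit 0)) (.read 1 (.lit a))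

theorem isExpr_coord (a : Fin D) :
    IsExpr fun m => coord (view m).mat ((view m).idx D) (m.nat 2 0) a :=
  IsExpr.mulVec (IsExpr.inv isExpr_block) isExpr_row a

theorem decides_lexPos {f : Memory → Fin D → ℝ} (hf : ∀ a, IsExpr fun m => f m a) :
    Decides fun m => LexPos ((view m).idx D) (m.nat 2 0) (f m) := by
  have hs := IsExpr.sum Finset.univ hf
  refine (Decides.lt .one hs).or ((Decides.eq hs .one).and ?_)
  have h1 : ∀ j : Fin D, Decides fun m => (view m).idx D j < m.nat 2 0 ∧ 0 < f m j ∧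
      ∀ l ∈ Finset.univ.filter fun l => l < j, f m l = 0 := fun j =>
    (Decides.natLt (.read 1 (.lit j)) (.read 2 (.lit 0))).and
      ((Decides.lt .zero (hf j)).and (.forall_mem _ fun l => .eq (hf l) .zero))
  simpa using Decides.exists_mem Finset.univ h1

theorem decides_member (s : Fin D → ℤˣ) (J : Finset (Fin D)) :
    Decides fun m => Member (view m).mat ((view m).idx D) s J (m.nat 2 0) := by
  have h1 : ∀ j : Fin D, Decides fun m => (view m).idx D j = m.nat 2 0 := fun j =>
    .natEq (.read 1 (.lit j)) (.read 2 (.lit 0))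
  have h2 := Decides.forall_mem Finset.univ fun j => (h1 j).not
  simp only [Finset.mem_univ, forall_true_left] at h2
  have h3 : ∀ j, IsExpr fun m =>
      ((s j : ℤ) : ℝ) * coord (view m).mat ((view m).idx D) (m.nat 2 0) j :=
    fun j => (IsExpr.unit _).mul (isExpr_coord j)
  exact (Decides.exists_mem J h1).or
    (h2.and ((decides_lexPos h3).or (decides_lexPos fun j => (h3 j).neg)))

end Expressions

/-! ### Loops over the indices -/

section Loops

variable {Φ : View → ℕ → Prop}

open Classical in
/-- Computing a sum in a real cell. -/
theorem feasible_sum (a b c : ℕ) (ha : a ≠ 0) (hΦ : Decides fun m => Φ (view m) (m.nat 2 0))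
    {F : View → ℕ → ℝ} (hF : IsExpr fun m => F (view m) (m.nat 2 0)) :
    Feasible 1 fun m m' => view m' = view m ∧
      (∀ x y z, (x, y, z) ≠ (a, b, c) → m'.real x y z = m.real x y z) ∧
      m'.real a b c = ∑ i ∈ (Finset.range (m.nat 0 0)).filter (Φ (view m)), F (view m) i := by
  have h1 := (Feasible.setConst a b c IsExpr.zero).mono zero_le_one
  have h2 := Feasible.ite hΦ (Feasible.setConst a b c
    ((IsExpr.constCell a b c).add hF)) Feasible.skip
  have h3 := h2.forLoop 2 0 two_ne_zero (by
    rintro m m' ⟨h, h'⟩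
    by_cases hm : Φ (view m) (m.nat 2 0)
    · rw [h hm]
      exact ⟨rfl, rfl⟩
    · rw [h' hm]
      exact ⟨rfl, rfl⟩)
  refine (h1.seq h3 (by rintro m _ rfl; rfl)).imp ?_
  rintro m m' ⟨_, rfl, -, h⟩
  have hv := view_storeReal m ha b c 0
  refine h (fun j m' => view m' = view m ∧
    (∀ x y z, (x, y, z) ≠ (a, b, c) → m'.real x y z = m.real x y z) ∧
    m'.real a b c = ∑ i ∈ (Finset.range j).filter (Φ (view m)), F (view m) i) ?_ ?_
  · rintro j m₁ m₂ - - hj ⟨i1, i2, i3⟩ ⟨r1, r2⟩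
    rw [view_storeNat _ le_rfl]
    simp only [Memory.storeNat]
    rw [Finset.sum_filter, Finset.sum_range_succ, ← Finset.sum_filter]
    rw [hj, i1] at r1 r2
    by_cases hm : Φ (view m) j
    · rw [r1 hm, if_pos hm, view_storeReal _ ha]
      refine ⟨i1, fun x y z hne => ?_, ?_⟩
      · rw [← i2 x y z hne]
        simp only [Memory.storeReal]
        rw [if_neg]
        rintro ⟨rfl, rfl, rfl⟩
        exact hne rfl
      · simp [Memory.storeReal, i3]
    · rw [r2 hm, if_neg hm, add_zero]
      exact ⟨i1, i2, i3⟩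
  · rw [view_storeNat _ le_rfl]
    refine ⟨hv, fun x y z hne => ?_, ?_⟩
    · simp only [Memory.storeNat, Memory.storeReal]
      rw [if_neg]
      rintro ⟨rfl, rfl, rfl⟩
      exact hne rfl
    · simp [Memory.storeNat, Memory.storeReal]

open Classical in
/-- Writing the output. -/
theorem feasible_output (hΦ : Decides fun m => Φ (view m) (m.nat 2 0))
    {F : Memory → ℕ → ℝ} (hF : IsExpr fun m => F m (m.nat 2 0))
    (hinv : ∀ m m', view m' = view m → m'.real 2 = m.real 2 → m'.real 3 = m.real 3 →
      F m' = F m) :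
    Feasible 1 fun m m' => view m' = view m ∧ m'.real 2 = m.real 2 ∧ m'.real 3 = m.real 3 ∧
      ∀ i < m.nat 0 0, m'.real 1 i 0 = if Φ (view m) i then F m i else 0 := by
  have h1 := Feasible.ite hΦ (Feasible.setReal 1 (.read 2 (.lit 0)) (.lit 0) hF)
    (Feasible.setReal 1 (.read 2 (.lit 0)) (.lit 0) IsExpr.zero)
  have h2 : Feasible 0 fun m m' => m' = m.storeReal 1 (m.nat 2 0) 0
      (if Φ (view m) (m.nat 2 0) then F m (m.nat 2 0) else 0) := by
    refine h1.imp ?_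
    rintro m m' ⟨h, h'⟩
    by_cases hm : Φ (view m) (m.nat 2 0)
    · rw [h hm, if_pos hm]; rfl
    · rw [h' hm, if_neg hm]; rfl
  refine (h2.forLoop 2 0 two_ne_zero (by rintro m _ rfl; exact ⟨rfl, rfl⟩)).imp ?_
  rintro m m' ⟨-, h⟩
  refine h (fun j m' => view m' = view m ∧ m'.real 2 = m.real 2 ∧ m'.real 3 = m.real 3 ∧
      ∀ i < j, m'.real 1 i 0 = if Φ (view m) i then F m i else 0) ?_ ?_
  · rintro j m₁ _ - - hj ⟨i1, i2, i3, i4⟩ rfl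
    -- By `hinv`, `F` does not depend on the output array that the loop overwrites, so its value is
    -- still that in the initial memory.
    rw [view_storeNat _ le_rfl, view_storeReal _ one_ne_zero, hj, i1, hinv _ _ i1 i2 i3]
    refine ⟨rfl, ?_, ?_, fun i hi => ?_⟩
    · simpa [Memory.storeNat, Memory.storeReal] using i2
    · simpa [Memory.storeNat, Memory.storeReal] using i3
    · simp only [Memory.storeNat, Memory.storeReal, true_and, and_true]
      rcases eq_or_ne i j with rfl | hne
      · rw [if_pos rfl]
      · rw [if_neg hne]
        exact i4 i (by omega)
  · exact ⟨view_storeNat _ le_rfl _ _, rfl, rfl, by simp⟩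

end Loops

/-! ### Treating one candidate -/

section Candidate

/-- The stored Gram matrix. -/
def storedGram (D : ℕ) (m : Memory) : Matrix (Fin D) (Fin D) ℝ := .of fun a b => m.real 2 a b

/-- The member of the matrix pencil at the stored root. -/
noncomputable def pencil (D : ℕ) (m : Memory) : Matrix (Fin D) (Fin D) ℝ :=
  m.real 3 0 2 • block (view m).mat ((view m).idx D) - storedGram D m

theorem isExpr_storedGram (a b : Fin D) : IsExpr fun m => storedGram D m a b :=
  IsExpr.constCell 2 a b

theorem isExpr_pencil (a b : Fin D) : IsExpr fun m => pencil D m a b :=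
  ((IsExpr.constCell 3 0 2).mul (isExpr_block a b)).sub (isExpr_storedGram a b)

theorem pencil_congr {m m' : Memory} (h : view m' = view m) (h2 : m'.real 2 = m.real 2)
    (h3 : m'.real 3 0 2 = m.real 3 0 2) : pencil D m' = pencil D m := by
  unfold pencil storedGram
  rw [h, h2, h3]

open Classical in
/-- Improving the output by means of a kernel vector. -/
theorem feasible_improve (s : Fin D → ℤˣ) (J : Finset (Fin D)) (k : ℕ) (b : Fin D) :
    Feasible 1 fun m m' => view m' = view m ∧ m'.real 2 = m.real 2 ∧
      m'.real 3 0 2 = m.real 3 0 2 ∧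
      ((m.real 3 0 1 < m.real 3 0 2 ∧ kernelVec k b (pencil D m) ≠ 0 ∧
        pencil D m *ᵥ kernelVec k b (pencil D m) = 0) →
        m'.real 3 0 1 = m.real 3 0 2 ∧ ∀ i < m.nat 0 0, m'.real 1 i 0 =
          if Member (view m).mat ((view m).idx D) s J i then
            (row (view m).mat ((view m).idx D) i ⬝ᵥ kernelVec k b (pencil D m)) /
              sSup {t : ℝ | t * t - kernelVec k b (pencil D m) ⬝ᵥ
                storedGram D m *ᵥ kernelVec k b (pencil D m) = 0}
          else 0) ∧
      (¬ (m.real 3 0 1 < m.real 3 0 2 ∧ kernelVec k b (pencil D m) ≠ 0 ∧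
        pencil D m *ᵥ kernelVec k b (pencil D m) = 0) → m' = m) := by
  have hz : ∀ a, IsExpr fun m => kernelVec k b (pencil D m) a := fun a =>
    isExpr_kernelVec k b a isExpr_pencil
  have hd1 : Decides fun m => kernelVec k b (pencil D m) ≠ 0 := by
    have := Decides.exists_mem Finset.univ fun a => (Decides.eq (hz a) .zero).not
    convert this using 2 with m
    rw [Function.ne_iff]
    simp
  have hd2 : Decides fun m => pencil D m *ᵥ kernelVec k b (pencil D m) = 0 := by
    have := Decides.forall_mem Finset.univ fun a => 
      Decides.eq (IsExpr.mulVec isExpr_pencil hz a) .zero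
    convert this using 2 with m
    rw [funext_iff]
    simp
  have hd := (Decides.lt (IsExpr.constCell 3 0 1)
    (IsExpr.constCell 3 0 2)).and (hd1.and hd2)
  have hq : IsExpr fun m => kernelVec k b (pencil D m) ⬝ᵥ
      storedGram D m *ᵥ kernelVec k b (pencil D m) :=
    .dotProduct hz (.mulVec isExpr_storedGram hz)
  -- In real array 3, row 0, cell 1 holds the best value so far, cell 2 the current root, and cell 3
  -- the norm of the new vector, a square root taken as the largest root of a quadratic.
  have p1 := (Feasible.setConst 3 0 1 (IsExpr.constCell 3 0 2)).mono
    zero_le_one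
  have p2 := (Feasible.setRoot 3 0 3
    ((IsPoly.id.mul IsPoly.id).sub (.of_isExpr hq))).mono zero_le_one
  have p3 := feasible_output (Φ := fun w i => Member w.mat (w.idx D) s J i) (decides_member s J) (F := fun m i =>
      (row (view m).mat ((view m).idx D) i ⬝ᵥ kernelVec k b (pencil D m)) / m.real 3 0 3)
    ((IsExpr.dotProduct isExpr_row hz).div (IsExpr.constCell 3 0 3))
    (fun m m' h h2 h3 => by
      funext i
      rw [pencil_congr h h2 (by rw [h3]), h, h3])
  refine (Feasible.ite hd ((p1.seq p2 (by rintro m _ rfl; rfl)).seq p3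
    (by rintro m _ ⟨_, rfl, rfl⟩; rfl)) (Feasible.skip.mono zero_le_one)).imp ?_
  rintro m m' ⟨h1, h2⟩
  by_cases hc : m.real 3 0 1 < m.real 3 0 2 ∧ kernelVec k b (pencil D m) ≠ 0 ∧
      pencil D m *ᵥ kernelVec k b (pencil D m) = 0
  · obtain ⟨_, ⟨_, rfl, rfl⟩, h3, h4, h5, h6⟩ := h1 hc
    rw [view_storeReal _ three_ne_zero, view_storeReal _ three_ne_zero] at h3 h6
    refine ⟨h3, ?_, ?_, fun _ => ⟨?_, fun i hi => ?_⟩, fun h => absurd hc h⟩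
    · rw [h4]
      simp [Memory.storeReal]
    · rw [h5]
      simp [Memory.storeReal]
    · rw [h5]
      simp [Memory.storeReal]
    · rw [h6 i hi]
      have e1 : ∀ v, pencil D (m.storeReal 3 0 1 v) = pencil D m := fun v =>
        pencil_congr (view_storeReal _ three_ne_zero _ _ _) (by simp [Memory.storeReal])
          (by simp [Memory.storeReal])
      have e2 : ∀ v w, pencil D ((m.storeReal 3 0 1 v).storeReal 3 0 3 w) = pencil D m :=
        fun v w => pencil_congr (by rw [view_storeReal _ three_ne_zero,
          view_storeReal _ three_ne_zero]) (by simp [Memory.storeReal])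
          (by simp [Memory.storeReal])
      have e3 : ∀ v, storedGram D (m.storeReal 3 0 1 v) = storedGram D m := fun v => by
        simp [storedGram, Memory.storeReal]
      have e4 : ∀ (n : Memory) w, (n.storeReal 3 0 3 w).real 3 0 3 = w := fun n w => by
        simp [Memory.storeReal]
      rw [e2, e1, e3, e4]
  · obtain rfl := h2 hc
    exact ⟨rfl, rfl, rfl, fun h => absurd h hc, fun _ => rfl⟩

/-- Computing the size of a candidate support and its Gram matrix. -/
theorem feasible_gram (s : Fin D → ℤˣ) (J : Finset (Fin D)) :
    Feasible 1 fun m m' => view m' = view m ∧ m'.real 1 = m.real 1 ∧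
      m'.real 3 0 1 = m.real 3 0 1 ∧ m'.real 3 0 4 = (((view m).supp s J).card : ℝ) ∧
      m'.real 3 0 5 = ((min (m.nat 0 1) (m.nat 0 0) : ℕ) : ℝ) ∧
      storedGram D m' = gram (view m).mat ((view m).idx D) ((view m).supp s J) := by
  classical
  have p1 := feasible_sum 3 0 4 three_ne_zero
    (Φ := fun w i => Member w.mat (w.idx D) s J i) (decides_member s J) (F := fun _ _ => 1) .one
  -- The machine does not convert naturals to reals, so `K` is also obtained by counting. The count
  -- stops at `N`, which is harmless since a support has at most `N` elements.
  have p2 := feasible_sum 3 0 5 three_ne_zero (Φ := fun w i => i < w.1 1)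
    (F := fun _ _ => 1) (.natLt (.read 2 (.lit 0)) (.read 0 (.lit 1))) .one
  have p3 : ∀ ab : Fin D × Fin D, _ := fun ab => feasible_sum 2 ab.1 ab.2 two_ne_zero
    (Φ := fun w i => Member w.mat (w.idx D) s J i) (decides_member s J)
    (F := fun w i => row w.mat (w.idx D) i ab.1 * row w.mat (w.idx D) i ab.2)
    ((isExpr_row ab.1).mul (isExpr_row ab.2))
  have p4 := Feasible.list Finset.univ.toList p3 (fun x m m' h => (view_eq h.1).1)
  refine ((p1.seq p2 fun m m' h => by rw [(view_eq h.1).1]).seq p4 (by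
    rintro m m' ⟨m₁, h, h'⟩
    rw [(view_eq h'.1).1, (view_eq h.1).1])).imp ?_
  rintro m m' ⟨m₂, ⟨m₁, ⟨a1, a2, a3⟩, b1, b2, b3⟩, -, h⟩
  obtain ⟨⟨i1, i2, i3⟩, -, hd⟩ := h (fun n => view n = view m ∧ n.real 1 = m₂.real 1 ∧
      n.real 3 = m₂.real 3) (fun ab n => n.real 2 ab.1 ab.2 =
        gram (view m).mat ((view m).idx D) ((view m).supp s J) ab.1 ab.2) (by
      rintro ab n₁ n₂ - ⟨j1, j2, j3⟩ ⟨r1, r2, r3⟩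
      have hN : n₁.nat 0 0 = m.nat 0 0 := by rw [(view_eq j1).1]
      rw [hN, j1] at r3
      refine ⟨⟨r1.trans j1, ?_, ?_⟩, r3, fun cd hcd => ?_⟩
      · rw [← j2]
        funext x y
        exact r2 _ _ _ (by simp)
      · rw [← j3]
        funext x y
        exact r2 _ _ _ (by simp)
      · by_cases he : ((2, (cd.1 : ℕ), (cd.2 : ℕ)) : ℕ × ℕ × ℕ) = (2, (ab.1 : ℕ), (ab.2 : ℕ))
        · simp only [Prod.mk.injEq, true_and, Fin.val_inj] at he
          rw [he.1, he.2]
          exact r3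
        · rw [r2 _ _ _ he, hcd]) ⟨b1.trans a1, rfl, rfl⟩
  refine ⟨i1, ?_, ?_, ?_, ?_, ?_⟩
  · rw [i2]
    funext x y
    rw [b2 _ _ _ (by simp), a2 _ _ _ (by simp)]
  · rw [i3, b2 _ _ _ (by simp), a2 _ _ _ (by simp)]
  · rw [i3, b2 _ _ _ (by simp), a3]
    simp [View.supp, view]
  · rw [i3, b3, a1, (view_eq a1).1]
    rw [Finset.sum_const, nsmul_eq_mul, mul_one]
    congr 1
    rw [← Finset.card_range (min (m.nat 0 1) (m.nat 0 0))]
    congr 1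
    ext i
    refine Iff.trans (@Finset.mem_filter ℕ _ (fun _ => Classical.propDecidable _) _ _) ?_
    rw [Finset.mem_range, Finset.mem_range, lt_min_iff, and_comm]
    rfl
  · ext a b
    exact hd (a, b) (by simp)

/-- The effect of treating one candidate support: the best value known so far is increased to the
largest generalized eigenvalue, and if it changes, then the output is changed to a corresponding
vector. -/
def Improves (s : Fin D → ℤˣ) (J : Finset (Fin D)) (m m' : Memory) : Prop :=
  view m' = view m ∧ m.real 3 0 1 ≤ m'.real 3 0 1 ∧
  ((m'.real 3 0 1 = m.real 3 0 1 ∧ m'.real 1 = m.real 1) ∨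
    ∃ z : Fin D → ℝ, (block (view m).mat ((view m).idx D)).det ≠ 0 ∧
      ((view m).supp s J).card ≤ m.nat 0 1 ∧ m.real 3 0 1 < m'.real 3 0 1 ∧ z ≠ 0 ∧
      (m'.real 3 0 1 • block (view m).mat ((view m).idx D) -
        gram (view m).mat ((view m).idx D) ((view m).supp s J)) *ᵥ z = 0 ∧
      ∀ i < m.nat 0 0, m'.real 1 i 0 =
        spread (view m).mat ((view m).idx D) ((view m).supp s J) z i /
          sSup {t : ℝ | t * t - z ⬝ᵥ
            gram (view m).mat ((view m).idx D) ((view m).supp s J) *ᵥ z = 0}) ∧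
  ((block (view m).mat ((view m).idx D)).det ≠ 0 →
    ((view m).supp s J).card ≤ m.nat 0 1 →
    (topRoot (view m).mat ((view m).idx D) ((view m).supp s J) •
      block (view m).mat ((view m).idx D) -
        gram (view m).mat ((view m).idx D) ((view m).supp s J)).det = 0 →
    topRoot (view m).mat ((view m).idx D) ((view m).supp s J) ≤ m'.real 3 0 1)

/-- Singular blocks and supports that are too large are skipped. Otherwise all vectors `kernelVec k
b` are tried, as it is not known which one works. Each is checked to be a nonzero kernel vector, so
a default value of the root does no harm; after a success the stored value equals the root, and the
strict comparison rejects the others. -/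
theorem feasible_improves (s : Fin D → ℤˣ) (J : Finset (Fin D)) : Feasible 1 (Improves s J) := by
  classical
  have hroot : IsPoly fun m t =>
      (t • block (view m).mat ((view m).idx D) - storedGram D m).det :=
    IsPoly.det fun a b => (IsPoly.id.mul (.of_isExpr (isExpr_block a b))).sub
      (.of_isExpr (isExpr_storedGram a b))
  have q1 := (Feasible.setRoot 3 0 2 hroot).mono zero_le_one
  have q2 := Feasible.list (Finset.univ : Finset (Fin (D + 1) × Fin D)).toList
    (fun kb => feasible_improve s J (kb.1 : ℕ) kb.2) (fun x m m' h => (view_eq h.1).1)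
  have q3 := Feasible.ite
    (Decides.lt (IsExpr.constCell 3 0 5) (IsExpr.constCell 3 0 4))
    (Feasible.skip.mono zero_le_one) (q1.seq q2 (by rintro m _ rfl; rfl))
  have q4 := (feasible_gram s J).seq q3 fun m m' h => by rw [(view_eq h.1).1]
  refine (Feasible.ite (Decides.eq (IsExpr.det (isExpr_block (D := D))) .zero)
    (Feasible.skip.mono zero_le_one) q4).imp ?_
  rintro m m' ⟨h1, h2⟩
  by_cases hdet : (block (view m).mat ((view m).idx D)).det = 0
  · obtain rfl := h1 hdet
    exact ⟨rfl, le_rfl, .inl ⟨rfl, rfl⟩, fun h => absurd hdet h⟩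
  obtain ⟨m₁, ⟨a1, a2, a3, a4, a5, a6⟩, h3, h4⟩ := h2 hdet
  have hle : ((view m).supp s J).card ≤ m.nat 0 0 := by
    refine (Finset.card_filter_le _ _).trans ?_
    rw [Finset.card_range]
    exact le_rfl
  have hcount : m₁.real 3 0 5 < m₁.real 3 0 4 ↔ ¬ ((view m).supp s J).card ≤ m.nat 0 1 := by
    rw [a4, a5, Nat.cast_lt]
    omega
  by_cases hc : m₁.real 3 0 5 < m₁.real 3 0 4
  · obtain rfl := h3 hc
    exact ⟨a1, a3.ge, .inl ⟨a3, a2⟩, fun _ h => absurd h (hcount.1 hc)⟩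
  obtain ⟨_, rfl, -, h5⟩ := h4 hc
  rw [hcount, not_not] at hc
  set B := block (view m).mat ((view m).idx D) with hB
  set S := (view m).supp s J with hS
  set G := gram (view m).mat ((view m).idx D) S with hG
  have htop : sSup {t : ℝ | (t • block (view m₁).mat ((view m₁).idx D) -
      storedGram D m₁).det = 0} = topRoot (view m).mat ((view m).idx D) S := by
    rw [a1, a6]
    rfl
  rw [htop] at h5
  set τ := topRoot (view m).mat ((view m).idx D) S with hτ
  obtain ⟨⟨i1, i2, i3, i4, i5⟩, -, hd⟩ := h5
    (fun n => view n = view m ∧ storedGram D n = G ∧ n.real 3 0 2 = τ ∧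
      m.real 3 0 1 ≤ n.real 3 0 1 ∧ ((n.real 3 0 1 = m.real 3 0 1 ∧ n.real 1 = m.real 1) ∨
        ∃ z : Fin D → ℝ, m.real 3 0 1 < n.real 3 0 1 ∧ z ≠ 0 ∧
          (n.real 3 0 1 • B - G) *ᵥ z = 0 ∧ ∀ i < m.nat 0 0, n.real 1 i 0 =
            spread (view m).mat ((view m).idx D) S z i /
              sSup {t : ℝ | t * t - z ⬝ᵥ G *ᵥ z = 0}))
    (fun kb n => kernelVec kb.1 kb.2 (τ • B - G) ≠ 0 →
      (τ • B - G) *ᵥ kernelVec kb.1 kb.2 (τ • B - G) = 0 → τ ≤ n.real 3 0 1) (by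
    rintro kb n₁ n₂ - ⟨j1, j2, j3, j4, j5⟩ ⟨r1, r2, r3, r4, r5⟩
    have hp : pencil D n₁ = τ • B - G := by
      rw [pencil, j1, j2, j3]
    rw [hp, j3, j2, j1] at r4
    rw [hp, j3] at r5
    by_cases hψ : n₁.real 3 0 1 < τ ∧ kernelVec kb.1 kb.2 (τ • B - G) ≠ 0 ∧
        (τ • B - G) *ᵥ kernelVec kb.1 kb.2 (τ • B - G) = 0
    · obtain ⟨s1, s2⟩ := r4 hψ
      refine ⟨⟨r1.trans j1, ?_, r3.trans j3, ?_, .inr ⟨_, ?_, hψ.2.1, ?_, fun i hi => ?_⟩⟩,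
        fun _ _ => s1.ge, fun _ _ _ _ => s1.ge⟩
      · rw [← j2]
        simp only [storedGram, r2]
      · rw [s1]
        exact j4.trans hψ.1.le
      · rw [s1]
        exact j4.trans_lt hψ.1
      · rw [s1]
        exact hψ.2.2
      · have hN : n₁.nat 0 0 = m.nat 0 0 := by rw [(view_eq j1).1]
        rw [s2 i (by rwa [hN]), spread]
        have hi' : i ∈ S ↔ Member (view m).mat ((view m).idx D) s J i := by
          rw [hS, View.supp, Finset.mem_filter, Finset.mem_range]
          exact and_iff_right hi
        by_cases hmem : i ∈ S
        · rw [if_pos hmem, if_pos (hi'.1 hmem)]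
        · rw [if_neg hmem, if_neg fun h => hmem (hi'.2 h), zero_div]
    · obtain rfl := r5 hψ
      refine ⟨⟨j1, j2, j3, j4, j5⟩, fun hz hz' => ?_, fun _ h => h⟩
      by_contra hlt
      exact hψ ⟨not_le.1 hlt, hz, hz'⟩) (by
    refine ⟨(view_storeReal _ three_ne_zero _ _ _).trans a1, ?_, ?_, ?_, .inl ⟨?_, ?_⟩⟩
    · rw [← a6]
      simp [storedGram, Memory.storeReal]
    · simp [Memory.storeReal]
    · simp [Memory.storeReal, a3]
    · simp [Memory.storeReal, a3]
    · simp [Memory.storeReal, a2])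
  refine ⟨i1, i4, ?_, fun _ _ hτ0 => ?_⟩
  · rcases i5 with h | ⟨z, z1, z2, z3, z4⟩
    · exact .inl h
    · exact .inr ⟨z, hdet, hc, z1, z2, z3, z4⟩
  · obtain ⟨k, hk, b, hb1, hb2⟩ := exists_kernelVec _ hτ0
    exact hd (⟨k, by omega⟩, b) (by simp) hb1 hb2

end Candidate

end SparsePCA

/-! ### The whole program -/

namespace SparsePCA

open Matrix RealRAM

variable {D N : ℕ}

/-! ### Recovering a multiple of the identity from the matrix -/

section Shift

/-- The multiple of the identity that is subtracted from the matrix: the smallest eigenvalue of a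
leading block of size `D + 1`, or a lower bound for the eigenvalues if the matrix is smaller. -/
noncomputable def shift (D N : ℕ) (E : Matrix ℕ ℕ ℝ) : ℝ :=
  if N < D + 1 then -(1 + ∑ a : Fin D, ∑ b : Fin D, E a b * E a b)
  else -sSup {t : ℝ | (t • (1 : Matrix (Fin (D + 1)) (Fin (D + 1)) ℝ) +
    E.submatrix Fin.val Fin.val).det = 0}

/-- Expanding `‖M x + x‖² ≥ 0` and using `‖M x‖² ≤ c ‖x‖²` gives `xᵀ M x ≥ -(c + 1) / 2 * ‖x‖²`,
which the shift by `1 + c` outweighs. -/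
theorem posDef_add_bound {n : ℕ} {M : Matrix (Fin n) (Fin n) ℝ} (hM : M.IsHermitian) :
    (M - (-(1 + ∑ a, ∑ b, M a b * M a b)) • (1 : Matrix (Fin n) (Fin n) ℝ)).PosDef := by
  set c := ∑ a, ∑ b, M a b * M a b with hc
  refine .of_dotProduct_mulVec_pos (hM.sub ?_) fun x hx => ?_
  · ext i j
    by_cases h : i = j
    · simp [h]
    · simp [one_apply, h, Ne.symm h]
  · have h1 : 0 < x ⬝ᵥ x := by
      simpa using (dotProduct_star_self_pos_iff (v := x)).2 hx
    have h2 : (M *ᵥ x) ⬝ᵥ (M *ᵥ x) ≤ c * (x ⬝ᵥ x) := by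
      rw [hc, Finset.sum_mul]
      refine Finset.sum_le_sum fun i _ => ?_
      have := Finset.sum_mul_sq_le_sq_mul_sq Finset.univ (M i) x
      simp only [sq] at this
      exact this
    have h3 : 0 ≤ (M *ᵥ x + x) ⬝ᵥ (M *ᵥ x + x) := by
      simpa using dotProduct_star_self_nonneg (M *ᵥ x + x)
    have hc0 : 0 ≤ c := Finset.sum_nonneg fun _ _ => Finset.sum_nonneg fun _ _ => mul_self_nonneg _
    rw [add_dotProduct, dotProduct_add, dotProduct_add, dotProduct_comm (M *ᵥ x) x] at h3
    rw [star_trivial, sub_mulVec, smul_mulVec, one_mulVec, dotProduct_sub, dotProduct_smul,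
      smul_eq_mul]
    nlinarith

/-- The shift need not equal `σ`: it suffices that the remainder is positive semidefinite of rank
`D`. In the case `N = D`, where `A` may be invertible, `σ` cannot be recovered. -/
theorem exists_shift_eq {σ : ℝ} {A : Matrix (Fin N) (Fin N) ℝ} (hA : A.PosSemidef)
    (hr : A.rank = D) {E : Matrix ℕ ℕ ℝ}
    (hE : ∀ i j : Fin N, E i j = (σ • (1 : Matrix (Fin N) (Fin N) ℝ) + A) i j) :
    ∃ A' : Matrix (Fin N) (Fin N) ℝ, A'.PosSemidef ∧ A'.rank = D ∧
      σ • (1 : Matrix (Fin N) (Fin N) ℝ) + A =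
        shift D N E • (1 : Matrix (Fin N) (Fin N) ℝ) + A' := by
  unfold shift
  split_ifs with hN
  · have hle : A.rank ≤ N := by
      simpa using A.rank_le_card_width
    obtain rfl : N = D := by omega
    have hC : (σ • (1 : Matrix (Fin N) (Fin N) ℝ) + A).IsHermitian := by
      refine IsHermitian.add ?_ hA.isHermitian
      ext i j
      by_cases h : i = j
      · simp [h]
      · simp [one_apply, h, Ne.symm h]
    have hpd := posDef_add_bound hC
    simp only [hE]
    refine ⟨_, hpd.posSemidef, ?_, (add_sub_cancel _ _).symm⟩
    rw [rank_of_isUnit _ hpd.isUnit, Fintype.card_fin]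
  · refine ⟨A, hA, hr, ?_⟩
    congr 2
    let e : Fin (D + 1) → Fin N := Fin.castLE (by omega)
    have hsub : E.submatrix Fin.val Fin.val =
        σ • (1 : Matrix (Fin (D + 1)) (Fin (D + 1)) ℝ) + A.submatrix e e := by
      ext i j
      have h1 := hE (e i) (e j)
      have h2 : (1 : Matrix (Fin N) (Fin N) ℝ) (e i) (e j) =
          (1 : Matrix (Fin (D + 1)) (Fin (D + 1)) ℝ) i j := by
        simp [one_apply, e]
      simp only [Matrix.add_apply, Matrix.smul_apply, h2] at h1
      exact h1
    have hA1 : (A.submatrix e e).PosSemidef := hA.submatrix e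
    -- The block of `A` has size `D + 1` and rank at most `D`, so `-σ` is a root; for larger `t` the
    -- matrix is positive definite.
    have hgreat : IsGreatest {t : ℝ | (t • (1 : Matrix (Fin (D + 1)) (Fin (D + 1)) ℝ) +
        E.submatrix Fin.val Fin.val).det = 0} (-σ) := by
      simp only [hsub, ← add_assoc, ← add_smul]
      constructor
      · change (_ : ℝ) = 0
        rw [neg_add_cancel, zero_smul, zero_add]
        by_contra hne
        have h1 := rank_of_isUnit _ ((isUnit_iff_isUnit_det _).2 (isUnit_iff_ne_zero.2 hne))
        have h2 := rank_submatrix_le A e e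
        rw [h1, Fintype.card_fin] at h2
        omega
      · intro t ht
        by_contra hlt
        have hpos : 0 < t + σ := by linarith
        have h1 := ((PosDef.one (n := Fin (D + 1)) (R := ℝ)).smul hpos).add_posSemidef hA1
        exact h1.det_pos.ne' ht
    rw [hgreat.csSup_eq, neg_neg]

end Shift

/-- Subtracting the shift from the diagonal, and initializing the output. -/
theorem feasible_prepare (D : ℕ) : Feasible 1 fun m m' => m'.nat 0 = m.nat 0 ∧
    m'.nat 1 = m.nat 1 ∧ m'.real 3 0 1 = m.real 3 0 1 ∧
    (∀ i j, m'.real 0 i j = if i = j ∧ i < m.nat 0 0 then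
      m.real 0 i j - shift D (m.nat 0 0) (.of (m.real 0)) else m.real 0 i j) ∧
    ∀ i, m'.real 1 i 0 = if i = 0 then 1 else m.real 1 i 0 := by
  have hroot : IsPoly fun m t => (t • (1 : Matrix (Fin (D + 1)) (Fin (D + 1)) ℝ) +
      (Matrix.of (m.real 0)).submatrix Fin.val Fin.val).det := by
    refine IsPoly.det fun a b => ?_
    refine (IsPoly.id.mul (.of_isExpr ?_)).add (.of_isExpr (IsExpr.constCell 0 a b))
    by_cases h : a = b
    · simpa [one_apply, h] using IsExpr.one
    · simpa [one_apply, h] using IsExpr.zero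
  have hsum : IsExpr fun m => -(1 + ∑ a : Fin D, ∑ b : Fin D,
      (Matrix.of (m.real 0)) a b * (Matrix.of (m.real 0)) a b) :=
    (IsExpr.one.add (.sum Finset.univ fun a : Fin D => .sum Finset.univ fun b : Fin D =>
      (IsExpr.constCell 0 a b).mul (IsExpr.constCell 0 a b))).neg
  have p1 := Feasible.ite (Decides.natLt (.read 0 (.lit 0)) (.lit (D + 1)))
    (Feasible.setConst 3 0 0 hsum)
    ((Feasible.setRoot 3 0 0 hroot).seq (Feasible.setConst 3 0 0 (IsExpr.constCell 3 0 0).neg)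
      (by rintro m _ rfl; rfl))
  have p1' : Feasible 0 fun m m' => m'.nat = m.nat ∧
      m'.real 3 0 0 = shift D (m.nat 0 0) (.of (m.real 0)) ∧ m'.real 0 = m.real 0 ∧
      m'.real 1 = m.real 1 ∧ m'.real 3 0 1 = m.real 3 0 1 := by
    refine p1.imp ?_
    rintro m m' ⟨h1, h2⟩
    simp only [NExpr.eval] at h1 h2
    by_cases hN : m.nat 0 0 < D + 1
    · obtain rfl := h1 hN
      simp [Memory.storeReal, shift, hN]
    · obtain ⟨_, rfl, rfl⟩ := h2 hN
      simp [Memory.storeReal, shift, hN]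
  have p2 : Feasible 0 fun m m' => m' = m.storeReal 0 (m.nat 2 0) (m.nat 2 0)
      (m.real 0 (m.nat 2 0) (m.nat 2 0) - m.real 3 0 0) :=
    Feasible.setReal 0 (.read 2 (.lit 0)) (.read 2 (.lit 0))
    ((IsExpr.cell 0 (.read 2 (.lit 0)) (.read 2 (.lit 0))).sub (IsExpr.constCell 3 0 0))
  have p3 := p2.forLoop 2 0 two_ne_zero (by rintro m _ rfl; exact ⟨rfl, rfl⟩)
  have p4 := (Feasible.setConst 1 0 0 IsExpr.one).mono zero_le_one
  refine (((p1'.mono zero_le_one).seq p3 (by rintro m m' ⟨h, -⟩; rw [h])).seq p4 (by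
    rintro m m' ⟨m₁, ⟨h, -⟩, h', -⟩; rw [h', h])).imp ?_
  rintro m _ ⟨m₂, ⟨m₁, ⟨a1, a2, a3, a4, a5⟩, -, h⟩, rfl⟩
  obtain ⟨i1, i2, i3, i4, i5⟩ := h (fun k n => n.nat 0 = m.nat 0 ∧ n.nat 1 = m.nat 1 ∧
      n.real 1 = m.real 1 ∧ n.real 3 = m₁.real 3 ∧ ∀ i j, n.real 0 i j =
        if i = j ∧ i < k then m.real 0 i j - shift D (m.nat 0 0) (.of (m.real 0))
        else m.real 0 i j) (by
    rintro k n₁ _ - - hk ⟨j1, j2, j3, j4, j5⟩ rfl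
    refine ⟨?_, ?_, ?_, ?_, fun i j => ?_⟩
    · simpa [Memory.storeReal, Memory.storeNat] using j1
    · simpa [Memory.storeReal, Memory.storeNat] using j2
    · simpa [Memory.storeReal, Memory.storeNat] using j3
    · simpa [Memory.storeReal, Memory.storeNat] using j4
    · simp only [Memory.storeReal, Memory.storeNat, hk, true_and]
      by_cases hik : i = k ∧ j = k
      · obtain ⟨rfl, rfl⟩ := hik
        simp [j5, j4, a2]
      · rw [if_neg hik, j5]
        have : (i = j ∧ i < k + 1) ↔ (i = j ∧ i < k) := by omega
        simp only [this]) (by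
    refine ⟨?_, ?_, a4, rfl, fun i j => ?_⟩
    · simp [Memory.storeNat, a1]
    · simp [Memory.storeNat, a1]
    · simp [Memory.storeNat, a3])
  rw [a1] at i5
  refine ⟨i1, i2, ?_, fun i j => ?_, fun i => ?_⟩
  · simp [Memory.storeReal, i4, a5]
  · rw [← i5]
    simp [Memory.storeReal]
  · simp [Memory.storeReal, i3]

/-! ### From indices in `ℕ` to indices in `Fin N` -/

section Transfer

variable {w : View} {A : Matrix (Fin N) (Fin N) ℝ} {I : Fin D → Fin N}

theorem block_eq (hw : ∀ i j : Fin N, w.mat i j = A i j) (hI : ∀ a, w.idx D a = I a) :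
    block w.mat (w.idx D) = block A I := by
  ext a b
  simp [block, hI, hw]

theorem row_eq (hw : ∀ i j : Fin N, w.mat i j = A i j) (hI : ∀ a, w.idx D a = I a) (i : Fin N) :
    row w.mat (w.idx D) i = row A I i := by
  ext a
  simp [row, hI, hw]

theorem member_iff (hw : ∀ i j : Fin N, w.mat i j = A i j) (hI : ∀ a, w.idx D a = I a)
    (s : Fin D → ℤˣ) (J : Finset (Fin D)) (i : Fin N) :
    Member w.mat (w.idx D) s J i ↔ Member A I s J i := by
  simp only [Member, LexPos, coord, block_eq hw hI, row_eq hw hI, hI, Fin.val_inj, ne_eq,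
    Fin.lt_def]

theorem supp_eq (hw : ∀ i j : Fin N, w.mat i j = A i j) (hI : ∀ a, w.idx D a = I a)
    (hN : w.1 0 = N) (s : Fin D → ℤˣ) (J : Finset (Fin D)) {S : Finset (Fin N)}
    (hS : ∀ i, i ∈ S ↔ Member A I s J i) : w.supp s J = S.map Fin.valEmbedding := by
  ext i
  simp only [View.supp, Finset.mem_filter, Finset.mem_range, Finset.mem_map,
    Fin.valEmbedding_apply, hS, hN]
  constructor
  · rintro ⟨hi, h⟩
    exact ⟨⟨i, hi⟩, (member_iff hw hI s J ⟨i, hi⟩).1 h, rfl⟩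
  · rintro ⟨i, h, rfl⟩
    exact ⟨i.2, (member_iff hw hI s J i).2 h⟩

theorem gram_eq (hw : ∀ i j : Fin N, w.mat i j = A i j) (hI : ∀ a, w.idx D a = I a)
    (S : Finset (Fin N)) : gram w.mat (w.idx D) (S.map Fin.valEmbedding) = gram A I S := by
  ext a b
  simp only [gram, of_apply, Finset.sum_map, Fin.valEmbedding_apply, row_eq hw hI]

theorem spread_eq (hw : ∀ i j : Fin N, w.mat i j = A i j) (hI : ∀ a, w.idx D a = I a)
    (S : Finset (Fin N)) (z : Fin D → ℝ) (i : Fin N) :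
    spread w.mat (w.idx D) (S.map Fin.valEmbedding) z i = spread A I S z i := by
  have : (i : ℕ) ∈ S.map Fin.valEmbedding ↔ i ∈ S := Finset.mem_map' Fin.valEmbedding
  unfold spread
  by_cases h : i ∈ S
  · rw [if_pos h, if_pos (this.2 h), row_eq hw hI]
  · rw [if_neg h, if_neg fun h' => h (this.1 h')]

end Transfer

theorem sSup_sq_sub {r : ℝ} (hr : 0 ≤ r) : sSup {t : ℝ | t * t - r = 0} = √r := by
  refine IsGreatest.csSup_eq ⟨?_, fun t ht => Real.le_sqrt_of_sq_le ?_⟩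
  · change √r * √r - r = 0
    rw [Real.mul_self_sqrt hr, sub_self]
  · have : t * t - r = 0 := ht
    rw [sq]
    linarith

/-- The state of the memory in the main part of the program: the output is a feasible vector, and
its value is at least the stored one. -/
def Valid (A : Matrix (Fin N) (Fin N) ℝ) (K : ℕ) (m : Memory) : Prop :=
  m.nat 0 0 = N ∧ m.nat 0 1 = K ∧ (∀ i j : Fin N, (view m).mat i j = A i j) ∧ 0 ≤ m.real 3 0 1 ∧
    output N m ∈ sparseSphere N K ∧
    m.real 3 0 1 ≤ (output N m).ofLp ⬝ᵥ A *ᵥ (output N m).ofLp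

/-- The stored value is at least the one of a given candidate. -/
def Beats (A : Matrix (Fin N) (Fin N) ℝ) (K : ℕ) (I : Fin D → Fin N) (s : Fin D → ℤˣ)
    (J : Finset (Fin D)) (m : Memory) : Prop :=
  ∀ S : Finset (Fin N), (block A I).det ≠ 0 → (∀ i, i ∈ S ↔ Member A I s J i) → S.card ≤ K →
    (topRoot A I S • block A I - gram A I S).det = 0 → topRoot A I S ≤ m.real 3 0 1

/-- The stored value is nonnegative, so a strictly larger root is positive; then `spread_value`
shows that the normalized vector attains it. -/
theorem Valid.improves {A : Matrix (Fin N) (Fin N) ℝ} (hA : A.PosSemidef) (hr : A.rank = D)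
    {K : ℕ} {I : Fin D → Fin N} {s : Fin D → ℤˣ} {J : Finset (Fin D)} {m m' : Memory}
    (h : Valid A K m) (hI : ∀ a, (view m).idx D a = I a) (hm : Improves s J m m') :
    Valid A K m' ∧ Beats A K I s J m' := by
  classical
  obtain ⟨hN, hK, hw, h0, hout, hval⟩ := h
  obtain ⟨hv, hle, hor, hbest⟩ := hm
  have hN' : (view m).1 0 = N := hN
  constructor
  · refine ⟨by rw [(view_eq hv).1, hN], by rw [(view_eq hv).1, hK], by rwa [hv], h0.trans hle, ?_⟩
    rcases hor with ⟨hb, hx⟩ | ⟨z, hdet, hcard, hlt, hz, hker, hx⟩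
    · have : output N m' = output N m := by
        unfold output
        rw [hx]
      rw [this, hb]
      exact ⟨hout, hval⟩
    · set S : Finset (Fin N) := Finset.univ.filter (Member A I s J) with hS
      have hsupp := supp_eq hw hI hN' s J (S := S) (by simp [hS])
      rw [hsupp, Finset.card_map, hK] at hcard
      rw [block_eq hw hI] at hdet
      rw [hsupp, block_eq hw hI, gram_eq hw hI] at hker
      obtain ⟨g1, g2⟩ := spread_value hA hr hdet (h0.trans_lt hlt) hz hker
      have hsq : √(z ⬝ᵥ gram A I S *ᵥ z) ^ 2 = z ⬝ᵥ gram A I S *ᵥ z := Real.sq_sqrt g1.le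
      have hout' : output N m' = WithLp.toLp 2
          fun i => spread A I S z i / √(z ⬝ᵥ gram A I S *ᵥ z) := by
        unfold output
        congr 1
        funext i
        rw [hx i (by rw [hN]; exact i.2), hsupp, gram_eq hw hI, spread_eq hw hI,
          sSup_sq_sub g1.le]
      rw [hout']
      refine ⟨normalize_mem (Real.sqrt_pos.2 g1) (by rw [spread_self, hsq]) hcard
        fun i hi => by simp [spread, hi], le_of_eq ?_⟩
      change _ = (fun i => spread A I S z i / √(z ⬝ᵥ gram A I S *ᵥ z)) ⬝ᵥ
        A *ᵥ (fun i => spread A I S z i / √(z ⬝ᵥ gram A I S *ᵥ z))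
      rw [quad_normalize, hsq, g2, mul_div_assoc, div_self g1.ne', mul_one]
  · intro S hdet hS hcard hroot
    have hsupp := supp_eq hw hI hN' s J hS
    have htop : topRoot (view m).mat ((view m).idx D) ((view m).supp s J) = topRoot A I S := by
      unfold topRoot
      rw [hsupp, block_eq hw hI, gram_eq hw hI]
    rw [htop, hsupp, block_eq hw hI, gram_eq hw hI, Finset.card_map, hK] at hbest
    exact hbest hdet hcard hroot

/-- Treating all candidates improves a valid state to one that beats all of them. -/
theorem feasible_search (D : ℕ) : Feasible (1 + D) fun m m' =>
    ∀ (N K : ℕ) (A : Matrix (Fin N) (Fin N) ℝ), A.PosSemidef → A.rank = D →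
      Valid A K m → (∀ e, m.nat 1 e = 0) →
        Valid A K m' ∧ ∀ (I : Fin D → Fin N) (s : Fin D → ℤˣ) (J : Finset (Fin D)),
          Beats A K I s J m' := by
  classical
  have hlist := Feasible.list (Finset.univ : Finset ((Fin D → ℤˣ) × Finset (Fin D))).toList
    (fun x => feasible_improves x.1 x.2) (fun x m m' h => (view_eq h.1).1)
  refine (hlist.nest D ?_).imp ?_
  · rintro m m' ⟨h1, h2⟩
    refine ⟨h1, (h2 (fun n => n.nat 1 = m.nat 1) (fun _ _ => True) ?_ rfl).1⟩
    intro x m₁ m₂ _ hm₁ hx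
    exact ⟨((view_eq hx.1).2.1).trans hm₁, trivial, fun _ _ => trivial⟩
  rintro m m' ⟨-, -, h⟩ N K A hA hr hvalid hzero
  have hNm := hvalid.1
  have key := h (Valid A K) (fun I n => ∀ I' : Fin D → Fin N, (∀ a : Fin D, I a = I' a) →
      ∀ s J, Beats A K I' s J n) ?_ (fun _ _ _ _ h => h) ?_ hvalid
  · refine ⟨key.1, fun I s J => ?_⟩
    -- Beyond `D` the counters keep their initial value zero, so the tuple is extended by zero.
    refine key.2.2 (fun e => if he : e < D then I ⟨e, he⟩ else 0) (fun e he => ?_)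
      (fun e he => ?_) I (fun a => by simp) s J
    · simp [he, hNm]
    · simp [not_lt.2 he, hzero]
  · rintro n e v ⟨h1, h2, h3, h4⟩
    exact ⟨by simpa [Memory.storeNat] using h1, by simpa [Memory.storeNat] using h2, h3, h4⟩
  · rintro m₁ m₂ hlt - hm₁ ⟨-, hl⟩
    rw [hNm] at hlt
    let I₀ : Fin D → Fin N := fun a => ⟨m₁.nat 1 a, hlt a a.2⟩
    obtain ⟨⟨i1, i2, i3⟩, -, i4⟩ := hl
      (fun n => Valid A K n ∧ n.nat 1 = m₁.nat 1 ∧ m₁.real 3 0 1 ≤ n.real 3 0 1)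
      (fun x n => Beats A K I₀ x.1 x.2 n) (by
        rintro x n₁ n₂ - ⟨j1, j2, j3⟩ hx
        have h1 := j1.improves hA hr (I := I₀) (fun a => congrFun j2 a) hx
        exact ⟨⟨h1.1, ((view_eq hx.1).2.1).trans j2, j3.trans hx.2.1⟩, h1.2,
          fun y hy S a b c d => (hy S a b c d).trans hx.2.1⟩) ⟨hm₁, rfl, le_rfl⟩
    refine ⟨i1, fun I' hI' s J => ?_, fun I hI I' hI' s J S a b c d =>
      (hI I' hI' s J S a b c d).trans i3⟩
    obtain rfl : I' = I₀ := funext fun a => Fin.ext (hI' a).symm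
    exact i4 (s, J) (by simp)

/-- The stored value lies between the optimum and the value of the output. If the optimum is not
positive, there may be no candidate for it, but the stored value is nonnegative anyway. -/
theorem isSparsePC_of_valid {A : Matrix (Fin N) (Fin N) ℝ} (hA : A.PosSemidef) (hr : A.rank = D)
    {K : ℕ} (hK : 1 ≤ K) (hN : 1 ≤ N) (σ : ℝ) {m : Memory} (h : Valid A K m)
    (hb : ∀ (I : Fin D → Fin N) (s : Fin D → ℤˣ) (J : Finset (Fin D)), Beats A K I s J m) :
    IsSparsePC (σ • (1 : Matrix (Fin N) (Fin N) ℝ) + A) K (output N m) := by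
  obtain ⟨-, -, -, h0, hout, hval⟩ := h
  refine ⟨hout, fun x hx => ?_⟩
  obtain ⟨y, hy, hmax⟩ := exists_isMaxOn A hK hN
  have hle : y.ofLp ⬝ᵥ A *ᵥ y.ofLp ≤ m.real 3 0 1 := by
    rcases le_or_gt (y.ofLp ⬝ᵥ A *ᵥ y.ofLp) 0 with hq | hq
    · exact hq.trans h0
    · obtain ⟨I, s, J, S, h1, h2, h3, h4, h5⟩ := exists_candidate hA hr hy hmax hq
      rw [← h4]
      exact hb I s J S h1 h2 h3 h5
  have hquad : ∀ v ∈ sparseSphere N K, v.ofLp ⬝ᵥ (σ • (1 : Matrix (Fin N) (Fin N) ℝ) + A) *ᵥ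
      v.ofLp = σ + v.ofLp ⬝ᵥ A *ᵥ v.ofLp := by
    intro v hv
    rw [add_mulVec, smul_mulVec, one_mulVec, dotProduct_add, dotProduct_smul,
      (mem_sparseSphere.1 hv).1, smul_eq_mul, mul_one]
  change x.ofLp ⬝ᵥ _ *ᵥ x.ofLp ≤ (output N m).ofLp ⬝ᵥ _ *ᵥ (output N m).ofLp
  rw [hquad x hx, hquad _ hout]
  linarith [hmax x hx]

end SparsePCA

theorem mainTheorem1 (D : ℕ) :
    ∃ (p : RealRAM.Program) (c : ℕ), ∀ (N : ℕ) (σ : ℝ) (A : Matrix (Fin N) (Fin N) ℝ),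
      A.PosSemidef → A.rank = D → ∀ K : ℕ, 1 ≤ K → K ≤ N →
        ∃ (t : ℕ) (m : RealRAM.Memory),
          RealRAM.Runs p
            (SparsePCA.input K (σ • (1 : Matrix (Fin N) (Fin N) ℝ) + A)) t m ∧
          t ≤ c * N ^ (D + 1) ∧
          SparsePCA.IsSparsePC (σ • (1 : Matrix (Fin N) (Fin N) ℝ) + A) K
            (SparsePCA.output N m) := by
  obtain ⟨p, c, hp⟩ := ((SparsePCA.feasible_prepare D).mono (Nat.le_add_right 1 D)).seq
    (SparsePCA.feasible_search D) fun m m' h => by rw [h.1]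
  -- The factor comes from `N + 1 ≤ 2 * N`.
  refine ⟨p, c * 2 ^ (D + 1), fun N σ A hA hr K hK hKN => ?_⟩
  have hN : 1 ≤ N := hK.trans hKN
  set C := σ • (1 : Matrix (Fin N) (Fin N) ℝ) + A with hC
  obtain ⟨t, m, hrun, ht, m₁, ⟨h1, h2, h3, h4, h5⟩, h6⟩ := hp (SparsePCA.input K C)
  have hin : (SparsePCA.input K C).nat 0 0 = N := rfl
  have hE : ∀ i j : Fin N, (Matrix.of ((SparsePCA.input K C).real 0)) i j = C i j := by
    intro i j
    simp [SparsePCA.input]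
  rw [hin] at ht h4
  refine ⟨t, m, hrun, ?_, ?_⟩
  · calc t ≤ c * (N + 1) ^ (1 + D) := ht
      _ ≤ c * (2 * N) ^ (1 + D) := by gcongr; omega
      _ = c * 2 ^ (D + 1) * N ^ (D + 1) := by rw [mul_pow, add_comm 1 D, mul_assoc]
  · obtain ⟨A', hA', hr', hAA⟩ := SparsePCA.exists_shift_eq hA hr hE
    -- The search starts with the first unit vector and the stored value zero, which is valid
    -- because `A'` is positive semidefinite.
    have hout : SparsePCA.output N m₁ = EuclideanSpace.single ⟨0, hN⟩ 1 := by
      ext i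
      simp [SparsePCA.output, h5, SparsePCA.input, Fin.ext_iff]
    have hsphere : SparsePCA.output N m₁ ∈ SparsePCA.sparseSphere N K := by
      rw [hout]
      refine ⟨by simp, le_trans ?_ hK⟩
      rw [Finset.card_le_one]
      intro i hi j hj
      simp at hi hj
      rw [hi, hj]
    have hbest : m₁.real 3 0 1 = 0 := by
      rw [h3]
      simp [SparsePCA.input]
    have hvalid : SparsePCA.Valid A' K m₁ := by
      refine ⟨by rw [h1, hin], by rw [h1]; rfl, fun i j => ?_, hbest.ge, hsphere, ?_⟩
      · change m₁.real 0 i j = _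
        rw [h4]
        have h7 : (SparsePCA.input K C).real 0 i j = C i j := hE i j
        rw [h7, show C i j = _ from congrFun (congrFun hAA i) j]
        by_cases hij : i = j
        · subst hij
          simp
        · have : ¬ ((i : ℕ) = j ∧ (i : ℕ) < N) := fun h => hij (Fin.ext h.1)
          rw [if_neg this]
          simp [hij]
      · rw [hbest]
        exact SparsePCA.quad_nonneg hA' _
    obtain ⟨g1, g2⟩ := h6 N K A' hA' hr' hvalid fun e => by rw [h2]; simp [SparsePCA.input]
    have := SparsePCA.isSparsePC_of_valid hA' hr' hK hN
      (SparsePCA.shift D N (Matrix.of ((SparsePCA.input K C).real 0))) g1 g2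
    rw [← hAA] at this
    exact this
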